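/- **Setting.** Let $d\ge 1$ be an integer, let $L,T>0$, and let $\mathbb T^d$ be the torus obtained from $[0,L]^d$ by identifying opposite sides. Let $\mathsf C^k$ be the space of functions on $\mathbb T^d$ all of whose partial derivatives of order at most $k$ exist and are continuous (including at the periodic boundaries), let $\|f\|_{\mathsf L^2}=\big(\int_{\mathbb T^d}|f|^2\,dx\big)^{1/2}$, $\|f\|_{\mathsf L^\infty}=\max_{\mathbb T^d}|f|$, and let $\nabla^{2m}$ denote the Laplacian applied $m$ times. Let $(p_t)_{t\in[0,T]}$ be probability density functions on $\mathbb T^d$ and $V_t:\mathbb T^d\to\mathbb R$ potentials such that the continuity equation $$\partial_t p_t(x)=-\nabla\cdot\big[p_t(x)\,\nabla V_t(x)\big]$$ holds for all $t\in[0,T]$ and $x\in\mathbb T^d$ (with one-sided time derivatives at $t=0$ and $t=T$). Let $N\ge 1$ be an integer power of $2$ and let $\mathbb X_N=\frac LN\{0,1,\dots,N-1\}$. For $x\in\mathbb X_N^d$ let $|x\rangle$ be the basis vector $|x_1N/L\rangle\otimes\cdots\otimes|x_dN/L\rangle$ of $(\mathbb C^{N})^{\otimes d}=\mathbb C^{N^d}$,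 and let $|\psi_t\rangle\propto\sum_{x\in\mathbb X_N^d}\sqrt{p_t(x)}\,|x\rangle$ be normalized to unit Euclidean norm. Let $$F=\frac1{\sqrt N}\sum_{j,\ell=0}^{N-1}e^{2\pi i j\ell/N}|j\rangle\langle \ell|,\quad S=\sum_{j=0}^{N-1}(-1)^j|j\rangle\langle j|,\quad D_K=\Big(\frac{2\pi}L\Big)^2\sum_{j=0}^{N-1}\Big(j-\frac N2\Big)^2|j\rangle\langle j|,$$ $$K=\tfrac12\big(SFD_KF^\dagger S^\dagger\big)^{\oplus d},\qquad D_{V_t}=\sum_{x\in\mathbb X_N^d}V_t(x)\,|x\rangle\langle x|,\qquad H_t^c=i[K,D_{V_t}],$$ where $M^{\oplus d}=M\otimes I\otimes\cdots\otimes I+\cdots+I\otimes\cdots\otimes I\otimes M$ is the $d$-fold Kronecker sum. Let $|\phi_t\rangle\in\mathbb C^{N^d}$ solve $i\frac{d}{dt}|\phi_t\rangle=H_t^c|\phi_t\rangle$ for $t\in[0,T]$, with an arbitrary initial vector $|\phi_0\rangle$. **Theorem.** Let $s\ge (d+7)/4$ be an integer. Suppose that $\sqrt{p_t},V_t\in\mathsf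 C^{2(s+1)}$ for every $t\in[0,T]$ and that, for every $x\in\mathbb T^d$, the quantities $V_t(x)$, $\nabla^2\sqrt{p_t(x)}$ and $\nabla^2[V_t(x)\sqrt{p_t(x)}]$ are continuous in $t\in[0,T]$. Define $$c_s=3\sup_{t\in[0,T]}\Big[\big(\|V_t\|_{\mathsf L^\infty}+1\big)\big\|\nabla^{2(s+1)}\sqrt{p_t}\big\|_{\mathsf L^2}+\big\|\nabla^{2(s+1)}(V_t\sqrt{p_t})\big\|_{\mathsf L^2}\Big]+1,$$ the supremum being assumed finite, and $$\delta=\big\||\psi_0\rangle-|\phi_0\rangle\big\|+T\,c_s\Big(\frac{Ld}{N}\Big)^{2s}.$$ If $\delta\le T$, then $\sum_{x\in\mathbb X_N^d}\sqrt{p_t(x)}\,|x\rangle\neq0$ for all $t\in[0,T]$ (so that $|\psi_t\rangle$ is a well-defined unit vector), and $$\big\||\psi_T\rangle-|\phi_T\rangle\big\|\le\delta .$$ -/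

import Mathlib

noncomputable section

namespace WavefunctionFlow

/-- Functions on the torus `𝕋^d` of edge length `L` are functions on `ℝ^d` that are `L`-periodic
in each coordinate. -/
def IsTorusPeriodic {d : ℕ} (L : ℝ) (f : EuclideanSpace ℝ (Fin d) → ℝ) : Prop :=
  ∀ (x : EuclideanSpace ℝ (Fin d)) (i : Fin d), f (x + EuclideanSpace.single i L) = f x

/-- The space `C^k(𝕋^d)` (real-valued functions). -/
def IsTorusCk {d : ℕ} (L : ℝ) (k : ℕ) (f : EuclideanSpace ℝ (Fin d) → ℝ) : Prop :=
  IsTorusPeriodic L f ∧ ContDiff ℝ k f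

/-- The fundamental domain `[0, L]^d` of the torus. -/
def cube (d : ℕ) (L : ℝ) : Set (EuclideanSpace ℝ (Fin d)) :=
  {x | ∀ i, x i ∈ Set.Icc 0 L}

/-- The norm of `L²(𝕋^d)`. -/
def torusL2Norm {d : ℕ} (L : ℝ) (f : EuclideanSpace ℝ (Fin d) → ℝ) : ℝ :=
  Real.sqrt (∫ x in cube d L, |f x| ^ 2)

/-- The norm of `L^∞(𝕋^d)` for a continuous function: the maximum of `|f|` over the torus. -/
def torusSupNorm {d : ℕ} (L : ℝ) (f : EuclideanSpace ℝ (Fin d) → ℝ) : ℝ :=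
  sSup ((fun x => |f x|) '' cube d L)

/-- The `m`-fold iterated Laplacian `∇^{2m} f`. -/
def iteratedLaplacian {d : ℕ} (m : ℕ) (f : EuclideanSpace ℝ (Fin d) → ℝ) :
    EuclideanSpace ℝ (Fin d) → ℝ :=
  (Laplacian.laplacian)^[m] f

/-- The divergence of a vector field on `ℝ^d`. -/
def divergence {d : ℕ} (v : EuclideanSpace ℝ (Fin d) → EuclideanSpace ℝ (Fin d))
    (x : EuclideanSpace ℝ (Fin d)) : ℝ :=
  ∑ i, fderiv ℝ (fun y => v y i) x (EuclideanSpace.single i 1)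

/-- `p` is a probability density function on the torus. -/
def IsTorusPDF {d : ℕ} (L : ℝ) (p : EuclideanSpace ℝ (Fin d) → ℝ) : Prop :=
  IsTorusPeriodic L p ∧ (∀ x, 0 ≤ p x) ∧ ∫ x in cube d L, p x = 1

/-- `p` obeys on `[0, T]` the continuity equation `∂ₜ pₜ = - ∇ · (pₜ ∇Vₜ)` with respect to the
conservative velocity field `∇Vₜ`. -/
def ContinuityEquation {d : ℕ} (T : ℝ) (p V : ℝ → EuclideanSpace ℝ (Fin d) → ℝ) : Prop :=
  ∀ t ∈ Set.Icc 0 T, ∀ x, HasDerivWithinAt (fun τ => p τ x)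
    (-divergence (fun y => p t y • gradient (V t) y) x) (Set.Icc 0 T) t

/-- The pointwise square root `√p`. -/
def sqrtFun {d : ℕ} (p : EuclideanSpace ℝ (Fin d) → ℝ) : EuclideanSpace ℝ (Fin d) → ℝ :=
  fun x => Real.sqrt (p x)

/-- The grid point `(L / N) j` for a tuple `j` in `{0, …, N-1}^d`. -/
def gridPoint {d N : ℕ} (L : ℝ) (j : Fin d → Fin N) : EuclideanSpace ℝ (Fin d) :=
  WithLp.toLp 2 (fun i => L / N * (j i : ℝ))

/-- The vector `∑ₓ f(x) |x⟩` of grid values. The basis vectors of `ℂ^{N^d} = (ℂ^N)^{⊗ d}` are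
indexed by tuples in `{0, …, N-1}^d`. -/
def gridVector {d : ℕ} (N : ℕ) (L : ℝ) (f : EuclideanSpace ℝ (Fin d) → ℝ) :
    EuclideanSpace ℂ (Fin d → Fin N) :=
  WithLp.toLp 2 (fun j => (f (gridPoint L j) : ℂ))

/-- The normalized grid qsample `∝ ∑ₓ √p(x) |x⟩`. -/
def qsample {d : ℕ} (N : ℕ) (L : ℝ) (p : EuclideanSpace ℝ (Fin d) → ℝ) :
    EuclideanSpace ℂ (Fin d → Fin N) :=
  ((‖gridVector N L (sqrtFun p)‖⁻¹ : ℝ) : ℂ) • gridVector N L (sqrtFun p)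

/-- The quantum Fourier transform matrix. -/
def matF (N : ℕ) : Matrix (Fin N) (Fin N) ℂ :=
  Matrix.of fun j l =>
    (1 / (Real.sqrt N : ℂ)) *
      Complex.exp (Complex.I * 2 * (Real.pi : ℂ) * ((j : ℕ) : ℂ) * ((l : ℕ) : ℂ) / (N : ℂ))

/-- The diagonal sign matrix. -/
def matS (N : ℕ) : Matrix (Fin N) (Fin N) ℂ :=
  Matrix.diagonal fun j => (-1 : ℂ) ^ (j : ℕ)

/-- The diagonal matrix of squared (shifted) wave numbers. -/
def matDK (N : ℕ) (L : ℝ) : Matrix (Fin N) (Fin N) ℂ :=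
  Matrix.diagonal fun j =>
    (((2 * Real.pi / L) ^ 2 * (((j : ℕ) : ℝ) - (N : ℝ) / 2) ^ 2 : ℝ) : ℂ)

/-- The tensor product `A₁ ⊗ ⋯ ⊗ A_d` of `N × N` matrices. -/
def tensorMatrix {d N : ℕ} (A : Fin d → Matrix (Fin N) (Fin N) ℂ) :
    Matrix (Fin d → Fin N) (Fin d → Fin N) ℂ :=
  Matrix.of fun j l => ∏ k, A k (j k) (l k)

/-- The `d`-fold Kronecker sum
`M ⊗ I ⊗ ⋯ ⊗ I + I ⊗ M ⊗ I ⊗ ⋯ ⊗ I + ⋯ + I ⊗ ⋯ ⊗ I ⊗ M`. -/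
def kroneckerSum {N : ℕ} (d : ℕ) (M : Matrix (Fin N) (Fin N) ℂ) :
    Matrix (Fin d → Fin N) (Fin d → Fin N) ℂ :=
  ∑ i : Fin d, tensorMatrix (Function.update (fun _ => 1) i M)

/-- The pseudo-spectral kinetic energy matrix `K = ½ (S F D_K F† S†)^{⊕ d}`. -/
def matK (d N : ℕ) (L : ℝ) : Matrix (Fin d → Fin N) (Fin d → Fin N) ℂ :=
  (1 / 2 : ℂ) • kroneckerSum d
    (matS N * matF N * matDK N L * (matF N).conjTranspose * (matS N).conjTranspose)

/-- The diagonal matrix `D_V` of the values of `V` on the grid. -/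
def matDV {d : ℕ} (N : ℕ) (L : ℝ) (V : EuclideanSpace ℝ (Fin d) → ℝ) :
    Matrix (Fin d → Fin N) (Fin d → Fin N) ℂ :=
  Matrix.diagonal fun j => (V (gridPoint L j) : ℂ)

/-- The discrete continuity Hamiltonian `i [K, D_V]`. -/
def discreteHamiltonian {d : ℕ} (N : ℕ) (L : ℝ) (V : EuclideanSpace ℝ (Fin d) → ℝ) :
    Matrix (Fin d → Fin N) (Fin d → Fin N) ℂ :=
  Complex.I • (matK d N L * matDV N L V - matDV N L V * matK d N L)

/-- `φ` solves on `[0, T]` the Schrödinger equation `i dφ/dt = H φ`, that is `dφ/dt = -i H φ`,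
with the Hamiltonian `H t`. -/
def SolvesSchrodinger {ι : Type*} [Fintype ι] [DecidableEq ι] (T : ℝ)
    (H : ℝ → Matrix ι ι ℂ) (φ : ℝ → EuclideanSpace ℂ ι) : Prop :=
  ∀ t ∈ Set.Icc 0 T,
    HasDerivWithinAt φ (-Complex.I • Matrix.toEuclideanLin (H t) (φ t)) (Set.Icc 0 T) t

/-- The quantity
`(‖Vₜ‖_∞ + 1) ‖∇^{2(s+1)} √pₜ‖₂ + ‖∇^{2(s+1)} (Vₜ √pₜ)‖₂` at one time. -/
def errorDensity {d : ℕ} (L : ℝ) (s : ℕ) (p V : EuclideanSpace ℝ (Fin d) → ℝ) : ℝ :=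
  (torusSupNorm L V + 1) * torusL2Norm L (iteratedLaplacian (s + 1) (sqrtFun p)) +
    torusL2Norm L (iteratedLaplacian (s + 1) (fun x => V x * sqrtFun p x))

/-- The constant `c_s`. -/
def errorConst {d : ℕ} (L T : ℝ) (s : ℕ) (p V : ℝ → EuclideanSpace ℝ (Fin d) → ℝ) : ℝ :=
  3 * sSup ((fun t => errorDensity L s (p t) (V t)) '' Set.Icc 0 T) + 1

end WavefunctionFlow

end

/-! Put `q = √p`. The continuity equation turns into `∂ₜq = -½ Δ(Vq) + ½ V Δq`, that is `i ∂ₜq =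
i[-½Δ, V] q`, which is a Schrödinger equation with a Hermitian Hamiltonian. The discrete Hamiltonian
has the same form with `K` in place of `-½Δ`. Sampling `q` on the grid therefore solves the discrete
equation up to a defect, which consists only of the error of `-2K` as a substitute for `Δ` on `q`
and on `Vq`.

That error is pure aliasing. On the grid the plane waves `k` and `k + N m` coincide, and for even
`N` the matrix `K` acts on both with the symbol of their representative near the origin. Only the
terms with `m ≠ 0` contribute, and these have `|k| ≥ N|m|/2`. Trading `s` powers of `|k|²` for
smoothness and applying Cauchy-Schwarz in `m` bounds the error by `(L/N)^(2s)` times the `L²` norm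
of the `(s+1)`-fold Laplacian (`norm_gridVector_laplacian_add_le`). The condition `4s ≥ d + 7` makes
the sum of `|m|^(-4s)` at most `2·3^d`, which powers of `π` absorb.

The defect must be small relative to the sampled vector, which is not normalized. Parseval and the
same alias estimate show that sampling keeps at least half of the expected norm `√((N/L)^d)`
(`norm_gridVector_ge`); the assumption `δ ≤ T` supplies the fineness needed there. Since the
discrete generator is skew-adjoint, errors grow only by integrating the relative defect, and
normalization costs a factor of two (`norm_normalized_sub_le`).

Two points need separate care: differentiating `√p` in time where `p` vanishes
(`hasDerivWithinAt_sqrt_of_eq`), and `N = 1`, the one odd power of two, where the discrete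
Hamiltonian is zero. -/

noncomputable section

/-! ### Fourier series and Parseval on the torus with period `L`. -/

namespace WavefunctionFlow

open MeasureTheory UnitAddTorus Filter
open scoped Topology Pointwise

variable {d : ℕ} {L : ℝ}

/-- The Haar probability measure of the unit circle, as used by `UnitAddTorus.mFourierCoeff`. -/
@[reducible] def unitCircleMeasureSpace : MeasureSpace UnitAddCircle := ⟨AddCircle.haarAddCircle⟩

attribute [local instance] unitCircleMeasureSpace

theorem isAddHaarMeasure_unitCircle : Measure.IsAddHaarMeasure (volume : Measure UnitAddCircle) :=
  inferInstanceAs (Measure.IsAddHaarMeasure AddCircle.haarAddCircle)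

theorem isProbabilityMeasure_unitCircle : IsProbabilityMeasure (volume : Measure UnitAddCircle) :=
  inferInstanceAs (IsProbabilityMeasure AddCircle.haarAddCircle)

attribute [local instance] isAddHaarMeasure_unitCircle isProbabilityMeasure_unitCircle

/-- The covering map from `ℝ^d` to the unit torus, with periods `L`. -/
def torusMk (L : ℝ) (x : EuclideanSpace ℝ (Fin d)) : UnitAddTorus (Fin d) :=
  fun i => ((x i / L : ℝ) : UnitAddCircle)

/-- The representative in `(0, L]^d` of a point of the unit torus. -/
def torusRep (L : ℝ) (θ : UnitAddTorus (Fin d)) : EuclideanSpace ℝ (Fin d) :=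
  WithLp.toLp 2 fun i => L * ((AddCircle.equivIoc 1 0 (θ i) : Set.Ioc (0 : ℝ) (0 + 1)) : ℝ)

theorem torusMk_torusRep (hL : 0 < L) (θ : UnitAddTorus (Fin d)) :
    torusMk L (torusRep L θ) = θ := by
  funext i
  simp only [torusMk, torusRep]
  rw [mul_div_cancel_left₀ _ hL.ne']
  exact (AddCircle.equivIoc 1 0).symm_apply_apply (θ i)

/-- The representative `torusRep` jumps at the faces of the cube, so continuity of a lifted function
is tested by pulling back along the covering map. -/
theorem isQuotientMap_torusMk (hL : 0 < L) : Topology.IsQuotientMap (torusMk (d := d) L) := by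
  have h1 : IsOpenQuotientMap
      (Pi.map (fun (_ : Fin d) (y : ℝ) => (y : UnitAddCircle))) :=
    IsOpenQuotientMap.piMap fun _ => QuotientAddGroup.isOpenQuotientMap_mk
  let e : EuclideanSpace ℝ (Fin d) ≃ₜ (Fin d → ℝ) :=
    (EuclideanSpace.equiv (Fin d) ℝ).toHomeomorph.trans
      (Homeomorph.piCongrRight fun _ => Homeomorph.mulRight₀ (L⁻¹) (inv_ne_zero hL.ne'))
  have h2 := h1.isQuotientMap.comp e.isQuotientMap
  convert! h2 using 1

/-- The periods of a function form a subgroup, which contains the lattice as soon as it contains the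
generators. -/
theorem IsTorusPeriodic.add_zsmul {f : EuclideanSpace ℝ (Fin d) → ℝ} (hf : IsTorusPeriodic L f)
    (m : Fin d → ℤ) (x : EuclideanSpace ℝ (Fin d)) :
    f (x + ∑ i, m i • EuclideanSpace.single i L) = f x := by
  let S : AddSubgroup (EuclideanSpace ℝ (Fin d)) :=
    { carrier := {a | ∀ x, f (x + a) = f x}
      zero_mem' := by simp
      add_mem' := by
        intro a b ha hb x
        rw [← add_assoc, hb, ha]
      neg_mem' := by
        intro a ha x
        rw [← ha (x + -a)]; simp }
  have : ∑ i, m i • EuclideanSpace.single i L ∈ S :=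
    S.sum_mem fun i _ => S.zsmul_mem (fun x => hf x i) _
  exact this x

theorem IsTorusPeriodic.eq_of_torusMk_eq {f : EuclideanSpace ℝ (Fin d) → ℝ} (hL : 0 < L)
    (hf : IsTorusPeriodic L f) {x y : EuclideanSpace ℝ (Fin d)} (h : torusMk L x = torusMk L y) :
    f x = f y := by
  have h1 : ∀ i, ∃ m : ℤ, y i = x i + m * L := by
    intro i
    have := congrFun h i
    simp only [torusMk] at this
    obtain ⟨m, hm⟩ := (QuotientAddGroup.eq_iff_sub_mem.1 this)
    refine ⟨-m, ?_⟩
    simp only [zsmul_eq_mul, mul_one] at hm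
    field_simp at hm
    push_cast
    linarith
  choose m hm using h1
  have : y = x + ∑ i, m i • EuclideanSpace.single i L := by
    ext j
    simp [hm, Finset.sum_apply, Pi.single_apply]
  rw [this, hf.add_zsmul]

/-- A periodic function, as a complex function on the unit torus. -/
def torusLift (L : ℝ) (f : EuclideanSpace ℝ (Fin d) → ℝ) (θ : UnitAddTorus (Fin d)) : ℂ :=
  (f (torusRep L θ) : ℂ)

theorem torusLift_torusMk {f : EuclideanSpace ℝ (Fin d) → ℝ} (hL : 0 < L)
    (hf : IsTorusPeriodic L f) (x : EuclideanSpace ℝ (Fin d)) :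
    torusLift L f (torusMk L x) = f x := by
  rw [torusLift, hf.eq_of_torusMk_eq hL (torusMk_torusRep hL (torusMk L x))]

theorem continuous_torusLift {f : EuclideanSpace ℝ (Fin d) → ℝ} (hL : 0 < L)
    (hf : IsTorusPeriodic L f) (hc : Continuous f) : Continuous (torusLift L f) := by
  rw [(isQuotientMap_torusMk hL).continuous_iff]
  have : torusLift L f ∘ torusMk L = fun x => (f x : ℂ) :=
    funext fun x => torusLift_torusMk hL hf x
  rw [this]
  fun_prop

theorem IsTorusPeriodic.exists_bound {f : EuclideanSpace ℝ (Fin d) → ℝ} (hL : 0 < L)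
    (hf : IsTorusPeriodic L f) (hc : Continuous f) : ∃ C, ∀ x, |f x| ≤ C := by
  obtain ⟨C, hC⟩ := isCompact_univ.exists_bound_of_continuousOn
    (continuous_torusLift hL hf hc).continuousOn
  refine ⟨C, fun x => ?_⟩
  have := hC (torusMk L x) trivial
  rwa [torusLift_torusMk hL hf, Complex.norm_real, Real.norm_eq_abs] at this

/-- The Fourier coefficients of a periodic function. -/
def fCoeff (L : ℝ) (f : EuclideanSpace ℝ (Fin d) → ℝ) (k : Fin d → ℤ) : ℂ :=
  mFourierCoeff (torusLift L f) k

theorem hasSum_fCoeff_mul {f : EuclideanSpace ℝ (Fin d) → ℝ} (hL : 0 < L)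
    (hf : IsTorusPeriodic L f) (hc : Continuous f) (h : Summable (fCoeff L f))
    (x : EuclideanSpace ℝ (Fin d)) :
    HasSum (fun k => fCoeff L f k * mFourier k (torusMk L x)) (f x) := by
  have := hasSum_mFourier_series_apply_of_summable
    (f := ⟨torusLift L f, continuous_torusLift hL hf hc⟩) h (torusMk L x)
  simpa [torusLift_torusMk hL hf, fCoeff] using this

/-- Half-open and closed cubes differ by a null set, and dilation by `L` contributes the factor `L ^
d`. The half-open unit cube is the form in which Haar integrals on the unit torus unfold. -/
theorem setIntegral_cube_eq {f : EuclideanSpace ℝ (Fin d) → ℝ} (hL : 0 < L) :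
    ∫ x in cube d L, f x = L ^ d *
      ∫ x in {x : Fin d → ℝ | ∀ i, x i ∈ Set.Ioc (0 : ℝ) (0 + 1)}, f (L • WithLp.toLp 2 x) := by
  have h1 : ∫ x in {x : Fin d → ℝ | ∀ i, x i ∈ Set.Ioc (0 : ℝ) (0 + 1)}, f (L • WithLp.toLp 2 x)
      = ∫ x in cube d 1, f (L • x) := by
    have e1 : {x : Fin d → ℝ | ∀ i, x i ∈ Set.Ioc (0 : ℝ) (0 + 1)} =
        Set.univ.pi fun _ => Set.Ioc (0 : ℝ) 1 := by
      ext; simp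
    have e2 : (WithLp.toLp 2) ⁻¹' (cube d 1) = Set.Icc (0 : Fin d → ℝ) 1 := by
      ext x; simp [cube, Pi.le_def, forall_and]
    rw [e1]
    have e3 : (Set.univ.pi fun _ => Set.Ioc (0 : ℝ) 1) =ᵐ[(volume : Measure (Fin d → ℝ))]
      Set.Icc (0 : Fin d → ℝ) 1 := Measure.univ_pi_Ioc_ae_eq_Icc (f := 0) (g := 1)
    rw [setIntegral_congr_set e3, ← e2]
    exact (PiLp.volume_preserving_toLp (Fin d)).setIntegral_preimage_emb
      (MeasurableEquiv.toLp 2 (Fin d → ℝ)).measurableEmbedding (fun x => f (L • x)) (cube d 1)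
  rw [h1, Measure.setIntegral_comp_smul_of_pos _ _ _ hL]
  have : L • cube d 1 = cube d L := by
    ext x
    rw [Set.mem_smul_set_iff_inv_smul_mem₀ hL.ne']
    simp only [cube, Set.mem_ofPred_eq, Set.mem_Icc, PiLp.smul_apply, smul_eq_mul]
    refine forall_congr' fun i => ?_
    rw [inv_mul_le_iff₀ hL, mul_one]
    exact and_congr_left fun _ => ⟨fun h => by
      have := mul_nonneg hL.le h
      rwa [mul_inv_cancel_left₀ hL.ne'] at this, fun h => by positivity⟩
  rw [this]
  simp only [finrank_euclideanSpace, Fintype.card_fin, smul_eq_mul]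
  rw [mul_inv_cancel_left₀ (pow_ne_zero _ hL.ne')]

theorem hasSum_sq_fCoeff {f : EuclideanSpace ℝ (Fin d) → ℝ} (hL : 0 < L)
    (hf : IsTorusPeriodic L f) (hc : Continuous f) :
    HasSum (fun k => ‖fCoeff L f k‖ ^ 2) ((L ^ d)⁻¹ * ∫ x in cube d L, |f x| ^ 2) := by
  let F : C(UnitAddTorus (Fin d), ℂ) := ⟨torusLift L f, continuous_torusLift hL hf hc⟩
  have h := hasSum_sq_mFourierCoeff (ContinuousMap.toLp 2 volume ℂ F)
  simp only [mFourierCoeff_toLp] at h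
  convert! h using 1
  have h2 : ∫ t, ‖(ContinuousMap.toLp 2 volume ℂ F) t‖ ^ 2 = ∫ t, ‖F t‖ ^ 2 := by
    refine integral_congr_ae ?_
    filter_upwards [ContinuousMap.coeFn_toLp volume F (p := 2) (𝕜 := ℂ)] with t ht
    rw [ht]
  rw [h2, setIntegral_cube_eq hL, inv_mul_cancel_left₀ (pow_ne_zero _ hL.ne'),
    UnitAddTorus.integral_preimage _ (fun _ => (0 : ℝ))]
  refine integral_congr_ae (Eventually.of_forall fun x => ?_)
  have : (fun i => (x i : UnitAddCircle)) = torusMk L (L • WithLp.toLp 2 x) := by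
    funext i
    simp [torusMk, mul_div_cancel_left₀ _ hL.ne']
  simp only [F, ContinuousMap.coe_mk, this, torusLift_torusMk hL hf, Complex.norm_real,
    Real.norm_eq_abs]

end WavefunctionFlow
end

/-! ### Derivatives and Laplacians as Fourier multipliers. -/

noncomputable section

namespace WavefunctionFlow

open MeasureTheory UnitAddTorus Filter
open scoped Topology Pointwise

variable {d : ℕ} {L : ℝ}

attribute [local instance] unitCircleMeasureSpace isAddHaarMeasure_unitCircle
  isProbabilityMeasure_unitCircle

/-- The partial derivative in the `i`-th coordinate direction. -/
def pderiv (i : Fin d) (f : EuclideanSpace ℝ (Fin d) → ℝ) (x : EuclideanSpace ℝ (Fin d)) : ℝ :=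
  fderiv ℝ f x (EuclideanSpace.single i 1)

theorem IsTorusPeriodic.pderiv {f : EuclideanSpace ℝ (Fin d) → ℝ} (hf : IsTorusPeriodic L f)
    (i : Fin d) : IsTorusPeriodic L (pderiv i f) := by
  intro x j
  have : (fun y => f (y + EuclideanSpace.single j L)) = f := funext fun y => hf y j
  unfold WavefunctionFlow.pderiv
  rw [← fderiv_comp_add_right, this]

theorem contDiff_pderiv {f : EuclideanSpace ℝ (Fin d) → ℝ} {n m : ℕ} (hf : ContDiff ℝ n f)
    (h : m + 1 ≤ n) (i : Fin d) : ContDiff ℝ m (pderiv i f) :=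
  (hf.fderiv_right (m := m) (by exact_mod_cast h)).clm_apply contDiff_const

theorem laplacian_eq_sum_pderiv {f : EuclideanSpace ℝ (Fin d) → ℝ} (hf : ContDiff ℝ 2 f)
    (x : EuclideanSpace ℝ (Fin d)) :
    Laplacian.laplacian f x = ∑ i, pderiv i (pderiv i f) x := by
  rw [InnerProductSpace.laplacian_eq_iteratedFDeriv_orthonormalBasis f
    (EuclideanSpace.basisFun (Fin d) ℝ)]
  refine Finset.sum_congr rfl fun i _ => ?_
  have h1 : DifferentiableAt ℝ (fderiv ℝ f) x :=
    (hf.fderiv_right (m := 1) (by norm_num)).differentiable (by norm_num) x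
  rw [iteratedFDeriv_two_apply]
  unfold pderiv
  rw [fderiv_clm_apply h1 (differentiableAt_const _)]
  simp

theorem mFourier_torusMk (k : Fin d → ℤ) (x : EuclideanSpace ℝ (Fin d)) :
    mFourier k (torusMk L x) = ∏ i, Complex.exp (2 * Real.pi * Complex.I * k i * (x i / L)) := by
  simp only [mFourier, ContinuousMap.coe_mk, torusMk]
  refine Finset.prod_congr rfl fun i _ => ?_
  rw [fourier_coe_apply]
  congr 1
  push_cast
  ring

theorem mFourier_apply_add (k : Fin d → ℤ) (θ η : UnitAddTorus (Fin d)) :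
    mFourier k (θ + η) = mFourier k θ * mFourier k η := by
  simp only [mFourier, ContinuousMap.coe_mk, ← Finset.prod_mul_distrib, Pi.add_apply,
    fourier_apply, smul_add, AddCircle.toCircle_add, Circle.coe_mul]

theorem torusMk_add (x y : EuclideanSpace ℝ (Fin d)) :
    torusMk L (x + y) = torusMk L x + torusMk L y := by
  funext i
  simp [torusMk, add_div]

theorem torusLift_add_torusMk {f : EuclideanSpace ℝ (Fin d) → ℝ} (hL : 0 < L)
    (hf : IsTorusPeriodic L f) (θ : UnitAddTorus (Fin d)) (v : EuclideanSpace ℝ (Fin d)) :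
    torusLift L f (θ + torusMk L v) = f (torusRep L θ + v) := by
  conv_lhs => rw [← torusMk_torusRep hL θ, ← torusMk_add, torusLift_torusMk hL hf]

theorem integral_mFourier_mul_torusLift_add (f : EuclideanSpace ℝ (Fin d) → ℝ) (k : Fin d → ℤ)
    (a : UnitAddTorus (Fin d)) :
    ∫ t, mFourier (-k) t * torusLift L f (t + a) = mFourier k a * fCoeff L f k := by
  have h1 : ∀ t, mFourier (-k) t * torusLift L f (t + a) =
      (fun s => mFourier k a * (mFourier (-k) s * torusLift L f s)) (t + a) := by
    intro t
    have : mFourier k a * mFourier (-k) a = 1 := by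
      rw [← mFourier_add, add_neg_cancel, mFourier_zero]; rfl
    simp only [mFourier_apply_add]
    linear_combination (-(mFourier (-k) t * torusLift L f (t + a))) * this
  simp_rw [h1]
  rw [integral_add_right_eq_self (μ := volume)
    (fun s => mFourier k a * (mFourier (-k) s * torusLift L f s)) a, integral_const_mul]
  rfl

/-- Translation replaces integration by parts: by invariance of Haar measure, shifting `f` by `h`
along the `i`-th axis multiplies its coefficient by `exp(2πi k_i h / L)`. Differentiating both sides
at `h = 0`, under the integral on the left, gives the symbol. -/
theorem fCoeff_pderiv {f : EuclideanSpace ℝ (Fin d) → ℝ} (hL : 0 < L)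
    (hf : IsTorusPeriodic L f) (hc : ContDiff ℝ 1 f) (i : Fin d) (k : Fin d → ℤ) :
    fCoeff L (pderiv i f) k = 2 * Real.pi * Complex.I * k i / L * fCoeff L f k := by
  have hdp : IsTorusPeriodic L (pderiv i f) := hf.pderiv i
  have hdc : Continuous (pderiv i f) :=
    (contDiff_pderiv (n := 1) (m := 0) (by exact_mod_cast hc) le_rfl i).continuous
  obtain ⟨C, hC⟩ := hdp.exists_bound hL hdc
  let a : ℝ → UnitAddTorus (Fin d) := fun h => torusMk L (EuclideanSpace.single i h)
  let F : ℝ → UnitAddTorus (Fin d) → ℂ := fun h t => mFourier (-k) t * torusLift L f (t + a h)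
  let F' : ℝ → UnitAddTorus (Fin d) → ℂ :=
    fun h t => mFourier (-k) t * torusLift L (pderiv i f) (t + a h)
  have hlift := continuous_torusLift hL hf hc.continuous
  have hlift' := continuous_torusLift hL hdp hdc
  have hFc : ∀ h, Continuous (F h) := fun h =>
    (mFourier (-k)).continuous.mul (hlift.comp (continuous_add_const _))
  have hFc' : ∀ h, Continuous (F' h) := fun h =>
    (mFourier (-k)).continuous.mul (hlift'.comp (continuous_add_const _))
  have key := (hasDerivAt_integral_of_dominated_loc_of_deriv_le (μ := volume) (F := F) (F' := F')
    (x₀ := (0 : ℝ)) (s := Set.univ) (bound := fun _ => C) univ_mem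
    (Eventually.of_forall fun h => (hFc h).aestronglyMeasurable)
    ((hFc 0).integrable_of_hasCompactSupport (HasCompactSupport.of_compactSpace _))
    (hFc' 0).aestronglyMeasurable
    (Eventually.of_forall fun t h _ => by
      simp only [F', a, torusLift_add_torusMk hL hdp, norm_mul, Complex.norm_real,
        Real.norm_eq_abs]
      have h1 : ‖mFourier (-k) t‖ ≤ 1 := by
        exact (ContinuousMap.norm_coe_le_norm _ _).trans_eq mFourier_norm
      calc _ ≤ 1 * C := mul_le_mul h1 (hC _) (abs_nonneg _) zero_le_one
        _ = C := one_mul C)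
    (integrable_const C)
    (Eventually.of_forall fun t h _ => by
      simp only [F, F', a, torusLift_add_torusMk hL hdp, torusLift_add_torusMk hL hf]
      refine HasDerivAt.const_mul _ ?_
      refine HasDerivAt.ofReal_comp ?_
      have h1 : HasDerivAt (fun h : ℝ => torusRep L t + EuclideanSpace.single i h)
          (EuclideanSpace.single i (1 : ℝ)) h := by
        have : (fun h : ℝ => torusRep L t + EuclideanSpace.single i h) =
            fun h : ℝ => torusRep L t + h • EuclideanSpace.single i (1 : ℝ) := by
          funext h; congr 1; ext j; simp
        rw [this]
        simpa using ((hasDerivAt_id h).smul_const (EuclideanSpace.single i (1 : ℝ))).const_add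
          (torusRep L t)
      exact ((hc.differentiable one_ne_zero _).hasFDerivAt).comp_hasDerivAt h h1)).2
  have e1 : (fun h => ∫ t, F h t) =
      fun h : ℝ => Complex.exp (h * (2 * Real.pi * Complex.I * k i / L)) * fCoeff L f k := by
    funext h
    simp only [F, a]
    rw [integral_mFourier_mul_torusLift_add, mFourier_torusMk,
      Finset.prod_eq_single i (fun j _ hj => by simp [hj]) (by simp)]
    congr 2
    simp
    ring
  have e2 : ∫ t, F' 0 t = fCoeff L (pderiv i f) k := by
    simp only [F', a]
    rw [integral_mFourier_mul_torusLift_add, mFourier_torusMk]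
    simp
  rw [e1, e2] at key
  have key2 : HasDerivAt
      (fun h : ℝ => Complex.exp (h * (2 * Real.pi * Complex.I * k i / L)) * fCoeff L f k)
      (2 * Real.pi * Complex.I * k i / L * fCoeff L f k) 0 := by
    have := (((Complex.ofRealCLM.hasDerivAt (x := (0 : ℝ))).mul_const
      (2 * Real.pi * Complex.I * k i / L)).cexp).mul_const (fCoeff L f k)
    simpa using this
  exact key.unique key2

theorem fCoeff_sum {ι : Type*} (s : Finset ι) {f : ι → EuclideanSpace ℝ (Fin d) → ℝ} (hL : 0 < L)
    (hf : ∀ i, IsTorusPeriodic L (f i)) (hc : ∀ i, Continuous (f i)) (k : Fin d → ℤ) :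
    fCoeff L (fun x => ∑ i ∈ s, f i x) k = ∑ i ∈ s, fCoeff L (f i) k := by
  simp only [fCoeff, mFourierCoeff, torusLift]
  rw [← integral_finsetSum]
  · simp [Finset.mul_sum]
  · intro i _
    exact Continuous.integrable_of_hasCompactSupport
      ((mFourier (-k)).continuous.smul (continuous_torusLift hL (hf i) (hc i)))
      (HasCompactSupport.of_compactSpace _)

/-- The squared Euclidean length of an integer vector. -/
def nsq (k : Fin d → ℤ) : ℝ := ∑ i, (k i : ℝ) ^ 2

theorem IsTorusCk.laplacian {f : EuclideanSpace ℝ (Fin d) → ℝ} {n : ℕ}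
    (hf : IsTorusCk L (n + 2) f) : IsTorusCk L n (Laplacian.laplacian f) := by
  have h2 : ContDiff ℝ 2 f := hf.2.of_le (by exact_mod_cast Nat.le_add_left 2 n)
  have : Laplacian.laplacian f = fun x => ∑ i, pderiv i (pderiv i f) x :=
    funext (laplacian_eq_sum_pderiv h2)
  rw [this]
  constructor
  · intro x j
    exact Finset.sum_congr rfl fun i _ => (hf.1.pderiv i).pderiv i x j
  · exact ContDiff.sum fun i _ =>
      contDiff_pderiv (contDiff_pderiv (m := n + 1) hf.2 le_rfl i) le_rfl i

theorem fCoeff_laplacian {f : EuclideanSpace ℝ (Fin d) → ℝ} (hL : 0 < L)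
    (hf : IsTorusCk L 2 f) (k : Fin d → ℤ) :
    fCoeff L (Laplacian.laplacian f) k =
      -(((2 * Real.pi / L) ^ 2 * nsq k : ℝ) : ℂ) * fCoeff L f k := by
  have h2 : ContDiff ℝ 2 f := hf.2
  have h1 : ∀ i, ContDiff ℝ 1 (pderiv i f) := fun i =>
    contDiff_pderiv (n := 2) (m := 1) hf.2 le_rfl i
  have : Laplacian.laplacian f = fun x => ∑ i, pderiv i (pderiv i f) x :=
    funext (laplacian_eq_sum_pderiv h2)
  rw [this, fCoeff_sum _ hL (fun i => (hf.1.pderiv i).pderiv i) (fun i =>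
    (contDiff_pderiv (n := 1) (m := 0) (h1 i) le_rfl i).continuous)]
  simp only [fCoeff_pderiv hL (hf.1.pderiv _) (h1 _),
    fCoeff_pderiv hL hf.1 (h2.of_le (by norm_num)), nsq]
  push_cast
  rw [Finset.mul_sum, ← Finset.sum_neg_distrib, Finset.sum_mul]
  refine Finset.sum_congr rfl fun i _ => ?_
  linear_combination (4 * Real.pi ^ 2 * (k i) ^ 2 / L ^ 2 * fCoeff L f k : ℂ) * Complex.I_sq

theorem IsTorusCk.of_le {f : EuclideanSpace ℝ (Fin d) → ℝ} {m n : ℕ}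
    (hf : IsTorusCk L n f) (h : m ≤ n) : IsTorusCk L m f :=
  ⟨hf.1, hf.2.of_le (by exact_mod_cast h)⟩

theorem IsTorusCk.iteratedLaplacian {f : EuclideanSpace ℝ (Fin d) → ℝ} {n : ℕ} (m : ℕ)
    (hf : IsTorusCk L (n + 2 * m) f) : IsTorusCk L n (iteratedLaplacian m f) := by
  induction m generalizing f with
  | zero => exact hf
  | succ m ih =>
    have : WavefunctionFlow.iteratedLaplacian (m + 1) f =
      WavefunctionFlow.iteratedLaplacian m (Laplacian.laplacian f) := Function.iterate_succ_apply _ _ _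
    rw [this]
    exact ih (IsTorusCk.laplacian (n := n + 2 * m) hf)

theorem norm_fCoeff_iteratedLaplacian {f : EuclideanSpace ℝ (Fin d) → ℝ} (hL : 0 < L) (m : ℕ)
    (hf : IsTorusCk L (2 * m) f) (k : Fin d → ℤ) :
    ‖fCoeff L (iteratedLaplacian m f) k‖ =
      ((2 * Real.pi / L) ^ 2 * nsq k) ^ m * ‖fCoeff L f k‖ := by
  induction m generalizing f with
  | zero => simp [iteratedLaplacian]
  | succ m ih =>
    have : iteratedLaplacian (m + 1) f =
      iteratedLaplacian m (Laplacian.laplacian f) := Function.iterate_succ_apply _ _ _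
    have hn : 0 ≤ nsq k := Finset.sum_nonneg fun i _ => sq_nonneg _
    rw [this, ih (IsTorusCk.laplacian (n := 2 * m) hf), fCoeff_laplacian hL (hf.of_le (by omega)),
      norm_mul, norm_neg, Complex.norm_real, Real.norm_of_nonneg (by positivity)]
    ring

end WavefunctionFlow
end

/-! ### Lattice sums and Cauchy-Schwarz for series. -/

noncomputable section

namespace WavefunctionFlow

open Filter
open scoped Topology

variable {d : ℕ}

theorem nsq_nonneg (k : Fin d → ℤ) : 0 ≤ nsq k := Finset.sum_nonneg fun _ _ => sq_nonneg _

theorem one_le_nsq {k : Fin d → ℤ} (hk : k ≠ 0) : 1 ≤ nsq k := by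
  obtain ⟨i, hi⟩ := Function.ne_iff.1 hk
  have h1 : (1 : ℝ) ≤ (k i : ℝ) ^ 2 := by
    have : (1 : ℤ) ≤ (k i) ^ 2 := by
      have := sq_pos_of_ne_zero (a := k i) hi
      omega
    exact_mod_cast this
  exact h1.trans (Finset.single_le_sum (f := fun i => (k i : ℝ) ^ 2)
    (fun _ _ => sq_nonneg _) (Finset.mem_univ i))

/-- Telescoping with `1/(M+1)² ≤ 1/M - 1/(M+1)`; the subtracted term makes the induction close. -/
theorem sum_range_inv_sq_le (M : ℕ) :
    ∑ r ∈ Finset.range M, 1 / ((r : ℝ) + 1) ^ 2 ≤ 2 - 1 / (M : ℝ) := by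
  induction M with
  | zero => simp
  | succ M ih =>
    rw [Finset.sum_range_succ]
    rcases Nat.eq_zero_or_pos M with rfl | hM
    · norm_num
    · have hM' : (0 : ℝ) < M := by exact_mod_cast hM
      have : 1 / ((M : ℝ) + 1) ^ 2 ≤ 1 / M - 1 / ((M : ℝ) + 1) := by
        rw [div_sub_div _ _ hM'.ne' (by positivity), div_le_div_iff₀ (by positivity) (by positivity)]
        nlinarith
      push_cast
      linarith

/-- The weights `|m|^{-2s}` on `ℤ^d`, vanishing at `0`. -/
def latticeWeight (s : ℕ) (m : Fin d → ℤ) : ℝ := ((nsq m)⁻¹) ^ s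

/-- Points are grouped by their sup norm `r m`. A box of radius `k + 1` holds at most `(3(k+1))^d`
lattice points, each of weight at most `(k+1)^(-(d+7))`, so the sum is controlled by `3^d` times the
sum of inverse squares. -/
theorem sum_sq_latticeWeight_le {s : ℕ} (hs : d + 7 ≤ 4 * s) (S : Finset (Fin d → ℤ)) :
    ∑ m ∈ S, latticeWeight s m ^ 2 ≤ 2 * 3 ^ d := by
  let r : (Fin d → ℤ) → ℕ := fun m => Finset.univ.sup fun i => (m i).natAbs
  have hr : ∀ m i, (m i).natAbs ≤ r m := fun m i =>
    Finset.le_sup (f := fun i => (m i).natAbs) (Finset.mem_univ i)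
  let M := S.sup r
  -- Each nonzero `m` is charged to the index `k = r m - 1`. The condition is `≤` rather than
  -- equality, so that after exchanging sums full boxes are counted instead of shells.
  have hterm : ∀ m ∈ S, latticeWeight s m ^ 2 ≤
      ∑ k ∈ Finset.range M, if r m ≤ k + 1 then 1 / ((k : ℝ) + 1) ^ (d + 7) else 0 := by
    intro m hm
    have hnn : ∀ k ∈ Finset.range M,
        (0 : ℝ) ≤ if r m ≤ k + 1 then 1 / ((k : ℝ) + 1) ^ (d + 7) else 0 := by
      intro k _; split_ifs <;> positivity
    rcases Nat.eq_zero_or_pos (r m) with h0 | h0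
    · have hm0 : m = 0 := by
        funext i
        have := hr m i
        simp only [Pi.zero_apply]; omega
      have : latticeWeight s m = 0 := by
        -- The weight at the origin is `(0⁻¹)^s = 0`, by the convention `0⁻¹ = 0` and `s ≠ 0`.
        have hs0 : s ≠ 0 := by omega
        simp [latticeWeight, hm0, nsq, hs0]
      rw [this]
      simpa using Finset.sum_nonneg hnn
    · have hrM : r m ≤ M := Finset.le_sup (f := r) hm
      have hle := Finset.single_le_sum hnn (a := r m - 1) (Finset.mem_range.2 (by omega))
      refine le_trans ?_ hle
      rw [if_pos (by omega)]
      have hcast : (((r m - 1 : ℕ) : ℝ) + 1) = r m := by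
        have : ((r m - 1 + 1 : ℕ) : ℝ) = r m := by congr 1; omega
        exact_mod_cast this
      rw [hcast]
      have hr1 : (1 : ℝ) ≤ r m := by exact_mod_cast h0
      obtain ⟨i, -, hi⟩ := Finset.exists_mem_eq_sup Finset.univ
        (by
          by_contra hne
          rw [Finset.not_nonempty_iff_eq_empty] at hne
          simp [r, hne] at h0) (fun i => (m i).natAbs)
      have hsq : (r m : ℝ) ^ 2 ≤ nsq m := by
        have e : (r m : ℝ) ^ 2 = (m i : ℝ) ^ 2 := by
          have : r m = (m i).natAbs := hi
          rw [this, Nat.cast_natAbs, Int.cast_abs, sq_abs]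
        rw [e]
        exact Finset.single_le_sum (f := fun i => (m i : ℝ) ^ 2)
          (fun _ _ => sq_nonneg _) (Finset.mem_univ i)
      rw [latticeWeight, ← pow_mul, inv_pow, one_div]
      apply inv_anti₀ (by positivity)
      calc (r m : ℝ) ^ (d + 7) ≤ (r m : ℝ) ^ (2 * (s * 2)) := pow_le_pow_right₀ hr1 (by omega)
        _ = ((r m : ℝ) ^ 2) ^ (s * 2) := pow_mul _ _ _
        _ ≤ nsq m ^ (s * 2) := pow_le_pow_left₀ (by positivity) hsq _
  refine (Finset.sum_le_sum hterm).trans ?_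
  rw [Finset.sum_comm]
  have hk : ∀ k ∈ Finset.range M,
      ∑ m ∈ S, (if r m ≤ k + 1 then 1 / ((k : ℝ) + 1) ^ (d + 7) else 0) ≤
        3 ^ d * (1 / ((k : ℝ) + 1) ^ 2) := by
    intro k _
    rw [← Finset.sum_filter, Finset.sum_const, nsmul_eq_mul]
    have hcard : (S.filter fun m => r m ≤ k + 1).card ≤ (2 * (k + 1) + 1) ^ d := by
      have hsub : (S.filter fun m => r m ≤ k + 1) ⊆
          Fintype.piFinset fun _ : Fin d => Finset.Icc (-((k : ℤ) + 1)) ((k : ℤ) + 1) := by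
        intro m hm
        rw [Fintype.mem_piFinset]
        intro i
        have h1 := hr m i
        have h2 := (Finset.mem_filter.1 hm).2
        rw [Finset.mem_Icc]
        omega
      refine (Finset.card_le_card hsub).trans ?_
      rw [Fintype.card_piFinset_const, Int.card_Icc]
      apply Nat.pow_le_pow_left
      omega
    have hcard' : ((S.filter fun m => r m ≤ k + 1).card : ℝ) ≤ (3 * ((k : ℝ) + 1)) ^ d := by
      calc ((S.filter fun m => r m ≤ k + 1).card : ℝ) ≤ ((2 * (k + 1) + 1) ^ d : ℕ) := by
            exact_mod_cast hcard
        _ ≤ (3 * ((k : ℝ) + 1)) ^ d := by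
          push_cast
          apply pow_le_pow_left₀ (by positivity)
          have : (0 : ℝ) ≤ k := k.cast_nonneg
          linarith
    have hk1 : (1 : ℝ) ≤ (k : ℝ) + 1 := by
      have : (0 : ℝ) ≤ k := k.cast_nonneg
      linarith
    calc _ ≤ (3 * ((k : ℝ) + 1)) ^ d * (1 / ((k : ℝ) + 1) ^ (d + 7)) :=
          mul_le_mul_of_nonneg_right hcard' (by positivity)
      _ = 3 ^ d * (1 / ((k : ℝ) + 1) ^ 7) := by
          rw [mul_pow, pow_add]; field_simp
      _ ≤ 3 ^ d * (1 / ((k : ℝ) + 1) ^ 2) := by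
          apply mul_le_mul_of_nonneg_left _ (by positivity)
          exact one_div_le_one_div_of_le (by positivity) (pow_le_pow_right₀ hk1 (by norm_num))
  refine (Finset.sum_le_sum hk).trans ?_
  rw [← Finset.mul_sum, mul_comm (2 : ℝ)]
  apply mul_le_mul_of_nonneg_left _ (by positivity)
  refine (sum_range_inv_sq_le M).trans ?_
  have : (0 : ℝ) ≤ 1 / (M : ℝ) := by positivity
  linarith

theorem summable_sq_latticeWeight {s : ℕ} (hs : d + 7 ≤ 4 * s) :
    Summable fun m : Fin d → ℤ => latticeWeight s m ^ 2 :=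
  summable_of_sum_le (fun _ => sq_nonneg _) (sum_sq_latticeWeight_le hs)

theorem tsum_sq_latticeWeight_le {s : ℕ} (hs : d + 7 ≤ 4 * s) :
    ∑' m : Fin d → ℤ, latticeWeight s m ^ 2 ≤ 2 * 3 ^ d :=
  (summable_sq_latticeWeight hs).tsum_le_of_sum_le (sum_sq_latticeWeight_le hs)

theorem summable_norm_of_le_mul {ι : Type*} {a : ι → ℂ} {b w : ι → ℝ}
    (ha : ∀ i, ‖a i‖ ≤ b i * w i) (hb : Summable fun i => b i ^ 2)
    (hw : Summable fun i => w i ^ 2) : Summable fun i => ‖a i‖ := by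
  refine Summable.of_nonneg_of_le (fun _ => norm_nonneg _) (fun i => ?_) (hb.add hw)
  nlinarith [ha i, sq_nonneg (b i - w i), sq_nonneg (b i), sq_nonneg (w i)]

theorem norm_tsum_sq_le {ι : Type*} {a : ι → ℂ} {b w : ι → ℝ}
    (ha : ∀ i, ‖a i‖ ≤ b i * w i) (hb : Summable fun i => b i ^ 2)
    (hw : Summable fun i => w i ^ 2) :
    ‖∑' i, a i‖ ^ 2 ≤ (∑' i, b i ^ 2) * ∑' i, w i ^ 2 := by
  have hs := summable_norm_of_le_mul ha hb hw
  have h1 : ‖∑' i, a i‖ ≤ √((∑' i, b i ^ 2) * ∑' i, w i ^ 2) := by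
    refine (norm_tsum_le_tsum_norm hs).trans (hs.tsum_le_of_sum_le fun S => ?_)
    apply Real.le_sqrt_of_sq_le
    calc (∑ i ∈ S, ‖a i‖) ^ 2 ≤ (∑ i ∈ S, b i * w i) ^ 2 := by
          gcongr with i hi
          · exact ha i
      _ ≤ (∑ i ∈ S, b i ^ 2) * ∑ i ∈ S, w i ^ 2 := Finset.sum_mul_sq_le_sq_mul_sq _ _ _
      _ ≤ _ := by
          apply mul_le_mul (hb.sum_le_tsum _ fun _ _ => sq_nonneg _)
            (hw.sum_le_tsum _ fun _ _ => sq_nonneg _) (Finset.sum_nonneg fun _ _ => sq_nonneg _)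
            (tsum_nonneg fun _ => sq_nonneg _)
  calc ‖∑' i, a i‖ ^ 2 ≤ √((∑' i, b i ^ 2) * ∑' i, w i ^ 2) ^ 2 := by gcongr
    _ = _ := Real.sq_sqrt (mul_nonneg (tsum_nonneg fun _ => sq_nonneg _)
      (tsum_nonneg fun _ => sq_nonneg _))

end WavefunctionFlow
end

/-! ### Plane waves on the grid and diagonalization of `K`. -/

noncomputable section

namespace WavefunctionFlow

open Filter Matrix
open scoped Topology ComplexConjugate

variable {d N : ℕ} {L : ℝ}

/-- The one-dimensional plane wave of wave number `k` on `{0, …, N-1}`. -/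
def wave (N : ℕ) (k : ℤ) (j : Fin N) : ℂ :=
  Complex.exp (2 * Real.pi * Complex.I * k * ((j : ℕ) / N))

theorem wave_eq_pow (k : ℤ) (j : Fin N) :
    wave N k j = Complex.exp (2 * Real.pi * Complex.I * k / N) ^ (j : ℕ) := by
  rw [wave, ← Complex.exp_nat_mul]
  congr 1
  ring

theorem wave_add (k l : ℤ) (j : Fin N) : wave N (k + l) j = wave N k j * wave N l j := by
  rw [wave, wave, wave, ← Complex.exp_add]
  congr 1
  push_cast
  ring

theorem conj_wave (k : ℤ) (j : Fin N) : conj (wave N k j) = wave N (-k) j := by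
  rw [wave, wave, ← Complex.exp_conj]
  congr 1
  simp only [map_mul, map_div₀, Complex.conj_ofReal, Complex.conj_I, Complex.conj_natCast,
    map_ofNat, map_intCast, Int.cast_neg]
  ring

theorem wave_natCast_mul (m : ℤ) (j : Fin N) : wave N (N * m) j = 1 := by
  have hN : (N : ℂ) ≠ 0 := by
    have := j.pos
    exact_mod_cast this.ne'
  rw [wave, Complex.exp_eq_one_iff]
  refine ⟨m * j, ?_⟩
  push_cast
  field_simp

theorem sum_wave (hN : 0 < N) (k : ℤ) :
    ∑ j : Fin N, wave N k j = if (N : ℤ) ∣ k then (N : ℂ) else 0 := by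
  split_ifs with h
  · obtain ⟨m, rfl⟩ := h
    simp [wave_natCast_mul]
  · have hN' : (N : ℂ) ≠ 0 := by exact_mod_cast hN.ne'
    have h1 : Complex.exp (2 * Real.pi * Complex.I * k / N) ≠ 1 := by
      intro he
      obtain ⟨m, hm⟩ := Complex.exp_eq_one_iff.1 he
      apply h
      refine ⟨m, ?_⟩
      have h2 : (2 * Real.pi * Complex.I : ℂ) ≠ 0 := Complex.two_pi_I_ne_zero
      have : (k : ℂ) = N * m := by
        field_simp at hm
        have h3 : (2 * Real.pi * Complex.I : ℂ) * (k - N * m) = 0 := by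
          linear_combination (2 * Real.pi * Complex.I : ℂ) * hm
        have := (mul_eq_zero.1 h3).resolve_left h2
        linear_combination this
      exact_mod_cast this
    simp_rw [wave_eq_pow]
    rw [Fin.sum_univ_eq_sum_range (fun j => Complex.exp (2 * Real.pi * Complex.I * k / N) ^ j),
      geom_sum_eq h1, ← Complex.exp_nat_mul, mul_div_cancel₀ _ hN']
    have : Complex.exp (2 * Real.pi * Complex.I * k) = 1 :=
      Complex.exp_eq_one_iff.2 ⟨k, by ring⟩
    rw [this]
    simp

/-- The plane wave of wave vector `k` on the grid. -/
def gridMode (N : ℕ) (k : Fin d → ℤ) : EuclideanSpace ℂ (Fin d → Fin N) :=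
  WithLp.toLp 2 fun j => ∏ i, wave N (k i) (j i)

theorem inner_gridMode (hN : 0 < N) (k l : Fin d → ℤ) :
    inner ℂ (gridMode N k) (gridMode N l) =
      if ∀ i, (N : ℤ) ∣ l i - k i then ((N : ℂ) ^ d) else 0 := by
  have h1 : inner ℂ (gridMode N k) (gridMode N l) =
      ∏ i, ∑ j : Fin N, wave N (l i - k i) j := by
    rw [Finset.prod_univ_sum, PiLp.inner_apply, Fintype.piFinset_univ]
    refine Finset.sum_congr rfl fun j _ => ?_
    simp only [gridMode, RCLike.inner_apply, map_prod, conj_wave, ← Finset.prod_mul_distrib,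
      ← wave_add, sub_eq_add_neg]
  rw [h1]
  simp_rw [sum_wave hN]
  split_ifs with h
  · simp [h]
  · push Not at h
    obtain ⟨i, hi⟩ := h
    exact Finset.prod_eq_zero (Finset.mem_univ i) (if_neg hi)

/-- Wave vectors, written as a wave vector in the Brillouin zone plus an alias shift. -/
def aliasIndex (N : ℕ) (q : (Fin d → Fin N) × (Fin d → ℤ)) : Fin d → ℤ :=
  fun i => ((q.1 i : ℕ) : ℤ) - ((N / 2 : ℕ) : ℤ) + N * q.2 i

theorem aliasIndex_bijective (hN : 0 < N) :
    Function.Bijective (aliasIndex (d := d) N) := by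
  have hN' : (0 : ℤ) < N := by exact_mod_cast hN
  constructor
  · rintro ⟨κ, m⟩ ⟨κ', m'⟩ h
    have h1 : ∀ i, κ i = κ' i ∧ m i = m' i := by
      intro i
      have hi := congrFun h i
      simp only [aliasIndex] at hi
      have h2 : ((κ i : ℕ) : ℤ) + N * m i = ((κ' i : ℕ) : ℤ) + N * m' i := by linarith
      have a1 : ((κ i : ℕ) : ℤ) < N := by exact_mod_cast (κ i).2
      have a2 : ((κ' i : ℕ) : ℤ) < N := by exact_mod_cast (κ' i).2
      have h3 := congrArg (· % (N : ℤ)) h2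
      simp only [Int.add_mul_emod_self_left] at h3
      rw [Int.emod_eq_of_lt (by omega) a1, Int.emod_eq_of_lt (by omega) a2] at h3
      refine ⟨Fin.ext (by exact_mod_cast h3), ?_⟩
      have : (N : ℤ) * m i = N * m' i := by linarith
      exact mul_left_cancel₀ hN'.ne' this
    exact Prod.ext (funext fun i => (h1 i).1) (funext fun i => (h1 i).2)
  · intro k
    have hpos : ∀ i, 0 ≤ (k i + (N / 2 : ℕ)) % (N : ℤ) := fun i => Int.emod_nonneg _ hN'.ne'
    refine ⟨⟨fun i => ⟨((k i + (N / 2 : ℕ)) % (N : ℤ)).toNat, ?_⟩,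
      fun i => (k i + (N / 2 : ℕ)) / (N : ℤ)⟩, ?_⟩
    · have := Int.emod_lt_of_pos (k i + (N / 2 : ℕ)) hN'
      have := hpos i
      omega
    · funext i
      simp only [aliasIndex]
      rw [Int.toNat_of_nonneg (hpos i)]
      have := Int.emod_add_mul_ediv (k i + (N / 2 : ℕ)) (N : ℤ)
      linarith

theorem gridMode_aliasIndex (κ : Fin d → Fin N) (m : Fin d → ℤ) :
    gridMode N (aliasIndex N (κ, m)) = gridMode N (aliasIndex N (κ, 0)) := by
  ext j
  simp only [gridMode]
  refine Finset.prod_congr rfl fun i _ => ?_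
  simp [aliasIndex, wave_add, wave_natCast_mul]

theorem norm_sq_sum_smul_gridMode (hN : 0 < N) (c : EuclideanSpace ℂ (Fin d → Fin N)) :
    ‖∑ κ, c κ • gridMode N (aliasIndex N (κ, 0))‖ ^ 2 = (N : ℝ) ^ d * ‖c‖ ^ 2 := by
  have hin : ∀ κ κ' : Fin d → Fin N, inner ℂ (gridMode N (aliasIndex N (κ, 0)))
      (gridMode N (aliasIndex N (κ', 0))) = if κ = κ' then (N : ℂ) ^ d else 0 := by
    intro κ κ'
    rw [inner_gridMode hN]
    congr 1
    rw [eq_iff_iff]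
    constructor
    · intro h
      funext i
      have hi := h i
      simp only [aliasIndex, Pi.zero_apply, mul_zero, add_zero, sub_sub_sub_cancel_right] at hi
      have := Int.eq_zero_of_abs_lt_dvd hi (by
        have a1 : ((κ i : ℕ) : ℤ) < N := by exact_mod_cast (κ i).2
        have a2 : ((κ' i : ℕ) : ℤ) < N := by exact_mod_cast (κ' i).2
        rw [abs_lt]; omega)
      apply Fin.ext
      omega
    · rintro rfl i
      simp
  have h : inner ℂ (∑ κ, c κ • gridMode N (aliasIndex N (κ, 0)))
      (∑ κ, c κ • gridMode N (aliasIndex N (κ, 0))) = (((N : ℝ) ^ d * ‖c‖ ^ 2 : ℝ) : ℂ) := by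
    simp only [sum_inner, inner_sum, inner_smul_left, inner_smul_right, hin]
    simp only [mul_ite, mul_zero, Finset.sum_ite_eq', Finset.mem_univ, if_true]
    rw [EuclideanSpace.norm_sq_eq]
    push_cast
    rw [Finset.mul_sum]
    refine Finset.sum_congr rfl fun κ _ => ?_
    rw [← Complex.conj_mul']
    ring
  rw [inner_self_eq_norm_sq_to_K] at h
  apply Complex.ofReal_injective
  rw [← h]
  push_cast
  rfl

/-- A sum of plane waves on the grid, with aliases collected. -/
theorem eq_sum_tsum_smul_gridMode {a : (Fin d → Fin N) × (Fin d → ℤ) → ℂ}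
    {v : EuclideanSpace ℂ (Fin d → Fin N)} (ha : Summable fun q => ‖a q‖)
    (hv : HasSum (fun q => a q • gridMode N (aliasIndex N q)) v) :
    v = ∑ κ, (∑' m, a (κ, m)) • gridMode N (aliasIndex N (κ, 0)) := by
  have h3 : ∀ κ, HasSum (fun m => a (κ, m) • gridMode N (aliasIndex N (κ, m)))
      ((∑' m, a (κ, m)) • gridMode N (aliasIndex N (κ, 0))) := by
    intro κ
    simp_rw [gridMode_aliasIndex]
    exact ((ha.of_norm.prod_factor κ).hasSum).smul_const _
  exact (hv.prod_fiberwise h3).unique (hasSum_fintype _)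

/-- The splitting of wave vectors, as an equivalence. -/
def aliasEquiv (d : ℕ) {N : ℕ} (hN : 0 < N) :
    (Fin d → Fin N) × (Fin d → ℤ) ≃ (Fin d → ℤ) :=
  Equiv.ofBijective _ (aliasIndex_bijective hN)

theorem aliasEquiv_apply (hN : 0 < N) (q : (Fin d → Fin N) × (Fin d → ℤ)) :
    aliasEquiv d hN q = aliasIndex N q := rfl

/-- The sign `(-1)^j = exp(-πij)` shifts every frequency by `N/2`, so the columns of `SF` are the
normalized waves with wave numbers `l - N/2`. This needs `N` even. -/
theorem matS_mul_matF_apply (M : ℕ) (hN : N = 2 * M) (j l : Fin N) :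
    (matS N * matF N) j l = (1 / (Real.sqrt N : ℂ)) * wave N ((l : ℕ) - M) j := by
  have hN0 : 0 < N := j.pos
  have hM : (M : ℂ) ≠ 0 := by
    have : M ≠ 0 := by omega
    exact_mod_cast this
  rw [matS, Matrix.diagonal_mul, matF, Matrix.of_apply, wave]
  have h1 : (-1 : ℂ) ^ (j : ℕ) = Complex.exp (-(Real.pi * Complex.I) * (j : ℕ)) := by
    rw [mul_comm, Complex.exp_nat_mul, Complex.exp_neg, Complex.exp_pi_mul_I]
    norm_num
  rw [h1, mul_left_comm, ← Complex.exp_add]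
  congr 2
  have hNc : (N : ℂ) = 2 * M := by exact_mod_cast hN
  rw [hNc]
  push_cast
  field_simp
  ring

/-- The one-dimensional kinetic matrix. -/
def kinetic1 (N : ℕ) (L : ℝ) : Matrix (Fin N) (Fin N) ℂ :=
  matS N * matF N * matDK N L * (matF N).conjTranspose * (matS N).conjTranspose

theorem kinetic1_eq (N : ℕ) (L : ℝ) : kinetic1 N L =
    (matS N * matF N) * matDK N L * (matS N * matF N).conjTranspose := by
  simp only [kinetic1, Matrix.conjTranspose_mul, Matrix.mul_assoc]

theorem kinetic1_isHermitian (N : ℕ) (L : ℝ) : (kinetic1 N L).IsHermitian := by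
  rw [kinetic1_eq]
  apply Matrix.isHermitian_mul_mul_conjTranspose
  rw [matDK]
  apply Matrix.isHermitian_diagonal_of_self_adjoint
  funext j
  simp [Complex.conj_ofReal]

/-- Orthogonality of characters sends the wave to a single coordinate vector under `(SF)†`. The
eigenvalue does not depend on the alias shift `m`, because the samples do not; this is the whole
source of the discretization error. -/
theorem kinetic1_mulVec_wave (M : ℕ) (hN : N = 2 * M) (κ : Fin N) (m : ℤ) :
    kinetic1 N L *ᵥ wave N ((κ : ℕ) - M + N * m) =
      (((2 * Real.pi / L) ^ 2 * (((κ : ℕ) : ℝ) - (N : ℝ) / 2) ^ 2 : ℝ) : ℂ) •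
        wave N ((κ : ℕ) - M + N * m) := by
  have hN0 : 0 < N := κ.pos
  have hsq : (Real.sqrt N : ℂ) * (Real.sqrt N : ℂ) = N := by
    rw [← Complex.ofReal_mul, Real.mul_self_sqrt (Nat.cast_nonneg N)]
    simp
  have hsq0 : (Real.sqrt N : ℂ) ≠ 0 := by
    have : (N : ℂ) ≠ 0 := by exact_mod_cast hN0.ne'
    intro h
    rw [h] at hsq
    exact this (by simpa using hsq.symm)
  have hw : wave N ((κ : ℕ) - M + N * m) = wave N ((κ : ℕ) - M) := by
    funext j
    rw [wave_add, wave_natCast_mul, mul_one]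
  have h1 : (matS N * matF N).conjTranspose *ᵥ wave N ((κ : ℕ) - M) =
      Pi.single κ (Real.sqrt N : ℂ) := by
    funext l
    have e : ∀ j, (matS N * matF N).conjTranspose l j * wave N ((κ : ℕ) - M) j =
        (1 / (Real.sqrt N : ℂ)) * wave N ((κ : ℕ) - (l : ℕ)) j := by
      intro j
      rw [Matrix.conjTranspose_apply, matS_mul_matF_apply M hN, star_mul', mul_assoc]
      congr 1
      · simp [Complex.conj_ofReal]
      · have : star (wave N ((l : ℕ) - M) j) = wave N (-((l : ℕ) - M)) j := conj_wave _ _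
        rw [this, ← wave_add]
        congr 1
        ring
    rw [Matrix.mulVec, dotProduct]
    simp_rw [e]
    rw [← Finset.mul_sum, sum_wave hN0]
    by_cases hl : l = κ
    · subst hl
      simp only [sub_self, dvd_zero, if_true, Pi.single_eq_same]
      rw [← hsq]
      field_simp
    · rw [if_neg, Pi.single_eq_of_ne hl, mul_zero]
      intro hd
      apply hl
      have := Int.eq_zero_of_abs_lt_dvd hd (by
        have a1 := κ.2
        have a2 := l.2
        rw [abs_lt]; omega)
      apply Fin.ext
      omega
  rw [hw, kinetic1_eq, ← Matrix.mulVec_mulVec, h1, ← Matrix.mulVec_mulVec]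
  funext j
  rw [matDK, Matrix.diagonal_mulVec_single, Matrix.mulVec_single]
  simp only [Matrix.col_apply, Pi.smul_apply, MulOpposite.smul_eq_mul_unop, MulOpposite.unop_op,
    smul_eq_mul]
  rw [matS_mul_matF_apply M hN]
  field_simp

theorem tensorMatrix_mulVec_prod (A : Fin d → Matrix (Fin N) (Fin N) ℂ)
    (v : Fin d → Fin N → ℂ) :
    tensorMatrix A *ᵥ (fun j => ∏ k, v k (j k)) = fun j => ∏ k, (A k *ᵥ v k) (j k) := by
  funext j
  simp only [Matrix.mulVec, dotProduct, tensorMatrix, Matrix.of_apply, ← Finset.prod_mul_distrib]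
  rw [Finset.prod_univ_sum, Fintype.piFinset_univ]

theorem kroneckerSum_mulVec_prod {M : Matrix (Fin N) (Fin N) ℂ} {v : Fin d → Fin N → ℂ}
    {μ : Fin d → ℂ} (h : ∀ i, M *ᵥ v i = μ i • v i) :
    kroneckerSum d M *ᵥ (fun j => ∏ k, v k (j k)) = (∑ i, μ i) • fun j => ∏ k, v k (j k) := by
  rw [kroneckerSum, Matrix.sum_mulVec, Finset.sum_smul]
  refine Finset.sum_congr rfl fun i _ => ?_
  rw [tensorMatrix_mulVec_prod]
  funext j
  rw [Pi.smul_apply, ← Finset.mul_prod_erase _ _ (Finset.mem_univ i),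
    ← Finset.mul_prod_erase _ _ (Finset.mem_univ i)]
  rw [Function.update_self, h, Pi.smul_apply, smul_eq_mul, smul_eq_mul, mul_assoc]
  congr 2
  refine Finset.prod_congr rfl fun k hk => ?_
  rw [Function.update_of_ne (Finset.ne_of_mem_erase hk), Matrix.one_mulVec]

theorem kroneckerSum_isHermitian (d : ℕ) {M : Matrix (Fin N) (Fin N) ℂ} (h : M.IsHermitian) :
    (kroneckerSum d M).IsHermitian := by
  rw [kroneckerSum, Matrix.IsHermitian, Matrix.conjTranspose_sum]
  refine Finset.sum_congr rfl fun i _ => ?_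
  ext j l
  simp only [Matrix.conjTranspose_apply, tensorMatrix, Matrix.of_apply, star_prod]
  refine Finset.prod_congr rfl fun k _ => ?_
  rcases eq_or_ne k i with rfl | hk
  · simp only [Function.update_self]
    exact h.apply _ _
  · simp only [Function.update_of_ne hk]
    exact Matrix.isHermitian_one.apply _ _

theorem matK_isHermitian (d N : ℕ) (L : ℝ) : (matK d N L).IsHermitian := by
  have h := kroneckerSum_isHermitian d (kinetic1_isHermitian N L)
  rw [Matrix.IsHermitian, matK, Matrix.conjTranspose_smul]
  change _ • (kroneckerSum d (kinetic1 N L)).conjTranspose = _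
  rw [h]
  simp [kinetic1]

theorem discreteHamiltonian_isHermitian (N : ℕ) (L : ℝ) (V : EuclideanSpace ℝ (Fin d) → ℝ) :
    (discreteHamiltonian N L V).IsHermitian := by
  have hV : (matDV N L V).IsHermitian := by
    rw [matDV]
    apply Matrix.isHermitian_diagonal_of_self_adjoint
    funext j
    simp [Complex.conj_ofReal]
  rw [Matrix.IsHermitian, discreteHamiltonian, Matrix.conjTranspose_smul, Matrix.conjTranspose_sub,
    Matrix.conjTranspose_mul, Matrix.conjTranspose_mul, hV, matK_isHermitian]
  simp only [RCLike.star_def, Complex.conj_I, neg_smul, smul_sub]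
  abel

theorem matK_gridMode (M : ℕ) (hN : N = 2 * M) (κ : Fin d → Fin N) (m : Fin d → ℤ) :
    Matrix.toEuclideanLin (matK d N L) (gridMode N (aliasIndex N (κ, m))) =
      (((2 * Real.pi / L) ^ 2 * nsq (aliasIndex N (κ, 0)) / 2 : ℝ) : ℂ) •
        gridMode N (aliasIndex N (κ, m)) := by
  have hM : N / 2 = M := by omega
  have h := kroneckerSum_mulVec_prod (M := kinetic1 N L)
    (v := fun i => wave N (aliasIndex N (κ, m) i))
    (μ := fun i => (((2 * Real.pi / L) ^ 2 * (((κ i : ℕ) : ℝ) - (N : ℝ) / 2) ^ 2 : ℝ) : ℂ))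
    (fun i => by
      have := kinetic1_mulVec_wave (L := L) M hN (κ i) (m i)
      simpa only [aliasIndex, hM] using this)
  apply (WithLp.equiv 2 _).injective
  change matK d N L *ᵥ (fun j => ∏ i, wave N (aliasIndex N (κ, m) i) (j i)) = _
  rw [matK, Matrix.smul_mulVec]
  change (1 / 2 : ℂ) • (kroneckerSum d (kinetic1 N L) *ᵥ _) = _
  rw [h]
  rw [smul_smul]
  change _ = (((2 * Real.pi / L) ^ 2 * nsq (aliasIndex N (κ, 0)) / 2 : ℝ) : ℂ) •
    (fun j : Fin d → Fin N => ∏ i, wave N (aliasIndex N (κ, m) i) (j i))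
  congr 1
  simp only [nsq, aliasIndex, hM, Finset.mul_sum, Finset.sum_div]
  push_cast
  refine Finset.sum_congr rfl fun i _ => ?_
  have hNc : (N : ℂ) = 2 * M := by exact_mod_cast hN
  rw [hNc]
  simp
  ring

end WavefunctionFlow
end

/-! ### Aliasing error of the pseudo-spectral Laplacian. -/

noncomputable section

namespace WavefunctionFlow

open Filter Matrix
open scoped Topology ComplexConjugate

variable {d N s : ℕ} {L : ℝ}

theorem mFourier_torusMk_gridPoint (hL : 0 < L) (k : Fin d → ℤ) (j : Fin d → Fin N) :
    UnitAddTorus.mFourier k (torusMk L (gridPoint L j)) = gridMode N k j := by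
  rw [mFourier_torusMk]
  simp only [gridMode, wave, gridPoint]
  refine Finset.prod_congr rfl fun i _ => ?_
  congr 2
  have : (L : ℂ) ≠ 0 := by exact_mod_cast hL.ne'
  push_cast
  field_simp

theorem hasSum_gridVector {f : EuclideanSpace ℝ (Fin d) → ℝ} (hL : 0 < L)
    (hf : IsTorusPeriodic L f) (hc : Continuous f) (h : Summable (fCoeff L f)) :
    HasSum (fun k => fCoeff L f k • gridMode N k) (gridVector N L f) := by
  have h1 : HasSum (fun k => fun j => fCoeff L f k * gridMode N k j)
      (fun j : Fin d → Fin N => (f (gridPoint L j) : ℂ)) := by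
    rw [Pi.hasSum]
    intro j
    have := hasSum_fCoeff_mul hL hf hc h (gridPoint L j)
    simpa only [mFourier_torusMk_gridPoint hL] using this
  exact (EuclideanSpace.equiv (Fin d → Fin N) ℂ).symm.hasSum.2 h1

theorem two_mul_abs_alias_le (κ : Fin N) :
    2 * |((κ : ℕ) : ℤ) - ((N / 2 : ℕ) : ℤ)| ≤ N := by
  have := κ.2
  rcases abs_cases (((κ : ℕ) : ℤ) - ((N / 2 : ℕ) : ℤ)) with h | h <;> omega

/-- In each coordinate the representative `a` satisfies `|a| ≤ N/2`, hence `|a + N m| ≥ N|m| - N/2 ≥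
N|m|/2` when `m ≠ 0`. -/
theorem nsq_alias_ge (κ : Fin d → Fin N) (m : Fin d → ℤ) :
    ((N : ℝ) / 2) ^ 2 * nsq m ≤ nsq (aliasIndex N (κ, m)) := by
  rw [nsq, nsq, Finset.mul_sum]
  refine Finset.sum_le_sum fun i _ => ?_
  rw [← mul_pow]
  apply sq_le_sq.2
  have h := two_mul_abs_alias_le (κ i)
  simp only [aliasIndex]
  generalize ((κ i : ℕ) : ℤ) - ((N / 2 : ℕ) : ℤ) = a at h
  have hz : (N : ℤ) * |m i| ≤ 2 * |a + N * m i| := by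
    rcases eq_or_ne (m i) 0 with h0 | h0
    · simp [h0]
    · have h1 : 1 ≤ |m i| := Int.one_le_abs h0
      have h2 : |(N : ℤ) * m i| ≤ |a + N * m i| + |a| := by
        have := abs_sub (a + N * m i) a
        simpa using this
      rw [abs_mul, Nat.abs_cast] at h2
      nlinarith
  have hr : (N : ℝ) * |(m i : ℝ)| ≤ 2 * |((a + N * m i : ℤ) : ℝ)| := by exact_mod_cast hz
  rw [abs_mul, abs_of_nonneg (by positivity : (0 : ℝ) ≤ (N : ℝ) / 2)]
  linarith

/-- The representative is shortest in its alias class, so replacing the symbol of `k` by that of its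
representative makes an error no larger than the symbol of `k`. -/
theorem nsq_alias_zero_le (κ : Fin d → Fin N) (m : Fin d → ℤ) :
    nsq (aliasIndex N (κ, 0)) ≤ nsq (aliasIndex N (κ, m)) := by
  refine Finset.sum_le_sum fun i _ => ?_
  apply sq_le_sq.2
  have h := two_mul_abs_alias_le (κ i)
  simp only [aliasIndex, Pi.zero_apply, mul_zero, add_zero]
  generalize ((κ i : ℕ) : ℤ) - ((N / 2 : ℕ) : ℤ) = a at h
  have hz : |a| ≤ |a + N * m i| := by
    rcases eq_or_ne (m i) 0 with h0 | h0
    · simp [h0]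
    · have h1 : 1 ≤ |m i| := Int.one_le_abs h0
      have h2 : |(N : ℤ) * m i| ≤ |a + N * m i| + |a| := by
        have := abs_sub (a + N * m i) a
        simpa using this
      rw [abs_mul, Nat.abs_cast] at h2
      nlinarith
  exact_mod_cast hz

/-- Cauchy-Schwarz is applied in the alias shift alone; as the weight is the same for every `κ`, the
remaining sums of `b ^ 2` assemble into a full Parseval sum. -/
theorem sum_norm_sq_tsum_le {ι μ : Type*} [Fintype ι] {a : ι × μ → ℂ} {b : ι × μ → ℝ} {w : μ → ℝ}
    (ha : ∀ q, ‖a q‖ ≤ b q * w q.2) (hb : Summable fun q => b q ^ 2)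
    (hw : Summable fun m => w m ^ 2) :
    ∑ κ, ‖∑' m, a (κ, m)‖ ^ 2 ≤ (∑' q, b q ^ 2) * ∑' m, w m ^ 2 := by
  rw [hb.tsum_prod, tsum_fintype, Finset.sum_mul]
  exact Finset.sum_le_sum fun κ _ => norm_tsum_sq_le (fun m => ha (κ, m)) (hb.prod_factor κ) hw

theorem torusL2Norm_sq (f : EuclideanSpace ℝ (Fin d) → ℝ) :
    torusL2Norm L f ^ 2 = ∫ x in cube d L, |f x| ^ 2 :=
  Real.sq_sqrt (MeasureTheory.integral_nonneg fun _ => by positivity)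

theorem torusL2Norm_nonneg (f : EuclideanSpace ℝ (Fin d) → ℝ) : 0 ≤ torusL2Norm L f :=
  Real.sqrt_nonneg _

theorem hasSum_sq_fCoeff_iteratedLaplacian {f : EuclideanSpace ℝ (Fin d) → ℝ} (hL : 0 < L)
    (hf : IsTorusCk L (2 * (s + 1)) f) :
    HasSum (fun k => (((2 * Real.pi / L) ^ 2 * nsq k) ^ (s + 1) * ‖fCoeff L f k‖) ^ 2)
      ((L ^ d)⁻¹ * torusL2Norm L (iteratedLaplacian (s + 1) f) ^ 2) := by
  have h0 : IsTorusCk L 0 (iteratedLaplacian (s + 1) f) :=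
    IsTorusCk.iteratedLaplacian (s + 1) (by simpa using hf)
  have := hasSum_sq_fCoeff hL h0.1 h0.2.continuous
  rw [torusL2Norm_sq]
  simpa only [norm_fCoeff_iteratedLaplacian hL (s + 1) hf] using this

/-- Multiplication by `(x / (y n))^s ≥ 1`: high frequency is traded for `s` additional powers of the
symbol. -/
theorem mul_norm_le_mul_inv_pow {x y n c : ℝ} (hy : 0 < y) (hn : 1 ≤ n) (hx : y * n ≤ x)
    (hc : 0 ≤ c) (s : ℕ) : x * c ≤ x ^ (s + 1) * c * ((y⁻¹) ^ s * (n⁻¹) ^ s) := by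
  have hx0 : 0 < x := lt_of_lt_of_le (by positivity) hx
  have h1 : 1 ≤ (x * (y⁻¹ * n⁻¹)) ^ s := by
    apply one_le_pow₀
    rw [← mul_inv, ← div_eq_mul_inv, one_le_div (by positivity)]
    exact hx
  calc x * c = x * c * 1 := (mul_one _).symm
    _ ≤ x * c * (x * (y⁻¹ * n⁻¹)) ^ s := by gcongr
    _ = _ := by rw [mul_pow, mul_pow, pow_succ]; ring

theorem norm_fCoeff_laplacian_le {f : EuclideanSpace ℝ (Fin d) → ℝ} (hL : 0 < L)
    (hf : IsTorusCk L (2 * (s + 1)) f) (k : Fin d → ℤ) :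
    ‖fCoeff L (Laplacian.laplacian f) k‖ ≤
      ((2 * Real.pi / L) ^ 2 * nsq k) ^ (s + 1) * ‖fCoeff L f k‖ *
        (((((2 * Real.pi / L) ^ 2)⁻¹) ^ s) * latticeWeight s k) := by
  have hpos : 0 < (2 * Real.pi / L) ^ 2 := by have := Real.pi_pos; positivity
  rw [fCoeff_laplacian hL (hf.of_le (by omega)), norm_mul, norm_neg, Complex.norm_real,
    Real.norm_of_nonneg (mul_nonneg hpos.le (nsq_nonneg k))]
  rcases eq_or_ne k 0 with rfl | hk
  · simp [nsq]
  · exact mul_norm_le_mul_inv_pow hpos (one_le_nsq hk) le_rfl (norm_nonneg _) s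

theorem summable_norm_fCoeff_laplacian {f : EuclideanSpace ℝ (Fin d) → ℝ} (hL : 0 < L)
    (hs : d + 7 ≤ 4 * s) (hf : IsTorusCk L (2 * (s + 1)) f) :
    Summable fun k => ‖fCoeff L (Laplacian.laplacian f) k‖ := by
  refine summable_norm_of_le_mul (norm_fCoeff_laplacian_le hL hf)
    (hasSum_sq_fCoeff_iteratedLaplacian hL hf).summable ?_
  simp_rw [mul_pow]
  exact (summable_sq_latticeWeight hs).mul_left _

theorem summable_norm_fCoeff {f : EuclideanSpace ℝ (Fin d) → ℝ} (hL : 0 < L)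
    (hs : d + 7 ≤ 4 * s) (hf : IsTorusCk L (2 * (s + 1)) f) :
    Summable fun k => ‖fCoeff L f k‖ := by
  have hcoef := fCoeff_laplacian hL (hf.of_le (m := 2) (by omega))
  have hpos : 0 < (2 * Real.pi / L) ^ 2 := by have := Real.pi_pos; positivity
  have h1 := (summable_norm_fCoeff_laplacian hL hs hf).mul_left (((2 * Real.pi / L) ^ 2)⁻¹)
  have h2 : ∀ᶠ k in cofinite, ‖fCoeff L f k‖ ≤
      ((2 * Real.pi / L) ^ 2)⁻¹ * ‖fCoeff L (Laplacian.laplacian f) k‖ := ?_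
  · exact (Summable.of_norm_bounded_eventually h1 h2).norm
  filter_upwards [(Set.finite_singleton (0 : Fin d → ℤ)).eventually_cofinite_notMem] with k hk0
  rw [hcoef, norm_mul, norm_neg, Complex.norm_real,
    Real.norm_of_nonneg (mul_nonneg hpos.le (nsq_nonneg k)), mul_assoc,
    inv_mul_cancel_left₀ hpos.ne']
  exact le_mul_of_one_le_left (norm_nonneg _) (one_le_nsq hk0)

/-- Follows from `π > 3` and `32 ≤ 3^7`; this is where the `7` in `d + 7` is used. -/
theorem two_mul_three_pow_le (hs : d + 7 ≤ 4 * s) :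
    2 * (3 : ℝ) ^ d ≤ 1 / 16 * Real.pi ^ (4 * s) := by
  have h1 : (3 : ℝ) ^ (d + 7) ≤ Real.pi ^ (4 * s) :=
    calc (3 : ℝ) ^ (d + 7) ≤ Real.pi ^ (d + 7) := by
          gcongr
          exact Real.pi_gt_three.le
      _ ≤ Real.pi ^ (4 * s) := pow_le_pow_right₀ (by linarith [Real.pi_gt_three]) hs
  rw [pow_add] at h1
  have : (0 : ℝ) < 3 ^ d := by positivity
  nlinarith

theorem two_pi_div_sq_mul_nsq_alias_ge (hL : 0 < L) (κ : Fin d → Fin N)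
    (m : Fin d → ℤ) : (Real.pi * N / L) ^ 2 * nsq m ≤
      (2 * Real.pi / L) ^ 2 * nsq (aliasIndex N (κ, m)) := by
  have h := mul_le_mul_of_nonneg_left (nsq_alias_ge κ m) (sq_nonneg (2 * Real.pi / L))
  refine le_trans (le_of_eq ?_) h
  field_simp

theorem sq_inv_pow_mul_le (hL : 0 < L) (hN : 0 < N) (hs : d + 7 ≤ 4 * s) :
    ∑' m : Fin d → ℤ, ((((Real.pi * N / L) ^ 2)⁻¹) ^ s * latticeWeight s m) ^ 2 ≤
      1 / 16 * ((L / N) ^ (2 * s)) ^ 2 := by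
  have hN' : (0 : ℝ) < N := by exact_mod_cast hN
  have hpi := Real.pi_pos
  simp_rw [mul_pow _ (latticeWeight s _)]
  rw [tsum_mul_left]
  have e : ((((Real.pi * N / L) ^ 2)⁻¹) ^ s) ^ 2 = ((L / N) ^ (2 * s)) ^ 2 / Real.pi ^ (4 * s) := by
    rw [inv_pow, inv_pow, ← pow_mul, ← pow_mul, ← pow_mul, show 2 * (s * 2) = 4 * s by ring,
      show 2 * s * 2 = 4 * s by ring, ← inv_pow, ← div_pow]
    congr 1
    field_simp
  have h2 := mul_le_mul_of_nonneg_left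
    ((tsum_sq_latticeWeight_le hs).trans (two_mul_three_pow_le hs))
    (sq_nonneg ((((Real.pi * N / L) ^ 2)⁻¹) ^ s))
  refine h2.trans (le_of_eq ?_)
  rw [e]
  field_simp

/-- The aliasing error of the pseudo-spectral Laplacian. -/
theorem norm_gridVector_laplacian_add_le {f : EuclideanSpace ℝ (Fin d) → ℝ} (hL : 0 < L)
    (hs : d + 7 ≤ 4 * s) (M : ℕ) (hM : N = 2 * M) (hN : 0 < N)
    (hf : IsTorusCk L (2 * (s + 1)) f) :
    ‖gridVector N L (Laplacian.laplacian f) +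
        (2 : ℂ) • Matrix.toEuclideanLin (matK d N L) (gridVector N L f)‖ ≤
      √((N / L) ^ d) * (1 / 4 * (L / N) ^ (2 * s) *
        torusL2Norm L (iteratedLaplacian (s + 1) f)) := by
  set c : ℝ := (2 * Real.pi / L) ^ 2 with hc
  have hpi := Real.pi_pos
  have hN' : (0 : ℝ) < N := by exact_mod_cast hN
  have hy : 0 < (Real.pi * N / L) ^ 2 := by positivity
  have hcpos : 0 < c := by positivity
  have hlap := summable_norm_fCoeff_laplacian hL hs hf
  have hsum := summable_norm_fCoeff hL hs hf
  have hf2 : IsTorusCk L 2 f := hf.of_le (by omega)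
  have hfl : IsTorusCk L 0 (Laplacian.laplacian f) := IsTorusCk.laplacian (n := 0) hf2
  have h1 : HasSum (fun q => fCoeff L (Laplacian.laplacian f) (aliasIndex N q) •
      gridMode N (aliasIndex N q)) (gridVector N L (Laplacian.laplacian f)) :=
    ((aliasEquiv d hN).hasSum_iff
      (f := fun k => fCoeff L (Laplacian.laplacian f) k • gridMode N k)).2
      (hasSum_gridVector hL hfl.1 hfl.2.continuous hlap.of_norm)
  have h2 : HasSum (fun q => fCoeff L f (aliasIndex N q) •
      gridMode N (aliasIndex N q)) (gridVector N L f) :=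
    ((aliasEquiv d hN).hasSum_iff (f := fun k => fCoeff L f k • gridMode N k)).2
      (hasSum_gridVector hL hf.1 hf.2.continuous hsum.of_norm)
  -- The error coefficient of mode `k`: symbol of its representative minus its own symbol, times the
  -- Fourier coefficient.
  let a : (Fin d → Fin N) × (Fin d → ℤ) → ℂ := fun q =>
    ((c * (nsq (aliasIndex N (q.1, 0)) - nsq (aliasIndex N q)) : ℝ) : ℂ) *
      fCoeff L f (aliasIndex N q)
  have h3 : HasSum (fun q => a q • gridMode N (aliasIndex N q))
      (gridVector N L (Laplacian.laplacian f) +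
        (2 : ℂ) • Matrix.toEuclideanLin (matK d N L) (gridVector N L f)) := by
    have h4 := ((Matrix.toEuclideanLin (matK d N L)).toContinuousLinearMap.hasSum h2).const_smul
      (2 : ℂ)
    refine (h1.add h4).congr_fun ?_
    rintro ⟨κ, m⟩
    simp only [LinearMap.coe_toContinuousLinearMap', map_smul, matK_gridMode M hM]
    rw [smul_smul, smul_smul, ← add_smul, fCoeff_laplacian hL hf2]
    congr 1
    simp only [a, ← hc]
    push_cast
    ring
  let b : (Fin d → Fin N) × (Fin d → ℤ) → ℝ := fun q =>
    (c * nsq (aliasIndex N q)) ^ (s + 1) * ‖fCoeff L f (aliasIndex N q)‖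
  have hb : HasSum (fun q => b q ^ 2)
      ((L ^ d)⁻¹ * torusL2Norm L (iteratedLaplacian (s + 1) f) ^ 2) :=
    ((aliasEquiv d hN).hasSum_iff
      (f := fun k => ((c * nsq k) ^ (s + 1) * ‖fCoeff L f k‖) ^ 2)).2
      (hasSum_sq_fCoeff_iteratedLaplacian hL hf)
  let w : (Fin d → ℤ) → ℝ := fun m => (((Real.pi * N / L) ^ 2)⁻¹) ^ s * latticeWeight s m
  have hw : Summable fun m => w m ^ 2 := by
    simp only [w, mul_pow]
    exact (summable_sq_latticeWeight hs).mul_left _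
  have ha : ∀ q, ‖a q‖ ≤ b q * w q.2 := by
    rintro ⟨κ, m⟩
    -- For `m = 0` the symbol is exact, so the vanishing weight at the origin does no harm.
    rcases eq_or_ne m 0 with rfl | hm
    · have hs0 : s ≠ 0 := by omega
      simp [a, w, latticeWeight, nsq, hs0]
    · simp only [a, b, w]
      have hz := nsq_alias_zero_le κ m
      have hz0 := nsq_nonneg (aliasIndex N (κ, (0 : Fin d → ℤ)))
      rw [norm_mul, Complex.norm_real, Real.norm_eq_abs]
      have h5 : |c * (nsq (aliasIndex N (κ, 0)) - nsq (aliasIndex N (κ, m)))| ≤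
          c * nsq (aliasIndex N (κ, m)) := by
        rw [abs_mul, abs_of_pos hcpos]
        apply mul_le_mul_of_nonneg_left _ hcpos.le
        rw [abs_le]
        constructor <;> linarith
      refine (mul_le_mul_of_nonneg_right h5 (norm_nonneg _)).trans ?_
      exact mul_norm_le_mul_inv_pow hy (one_le_nsq hm)
        (two_pi_div_sq_mul_nsq_alias_ge hL κ m) (norm_nonneg _) s
  -- Absolute summability permits regrouping by alias class; the Fourier coefficients of the
  -- Laplacian dominate.
  have hasum : Summable fun q => ‖a q‖ := by
    refine Summable.of_nonneg_of_le (fun _ => norm_nonneg _) (fun q => ?_)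
      (((aliasEquiv d hN).summable_iff
        (f := fun k => ‖fCoeff L (Laplacian.laplacian f) k‖)).2 hlap)
    simp only [Function.comp, aliasEquiv_apply, fCoeff_laplacian hL hf2, a, norm_mul, norm_neg,
      Complex.norm_real, Real.norm_eq_abs, ← hc]
    apply mul_le_mul_of_nonneg_right _ (norm_nonneg _)
    have hz := nsq_alias_zero_le q.1 q.2
    have hz0 := nsq_nonneg (aliasIndex N (q.1, (0 : Fin d → ℤ)))
    rw [abs_of_nonneg hcpos.le, abs_of_nonneg (nsq_nonneg _)]
    apply mul_le_mul_of_nonneg_left _ hcpos.le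
    rw [abs_le]
    constructor <;> linarith
  have hv := eq_sum_tsum_smul_gridMode hasum h3
  have hnorm := norm_sq_sum_smul_gridMode hN
    (WithLp.toLp 2 fun κ : Fin d → Fin N => ∑' m, a (κ, m))
  simp only at hnorm
  have hcoord : ‖(WithLp.toLp 2 fun κ : Fin d → Fin N => ∑' m, a (κ, m) :
      EuclideanSpace ℂ (Fin d → Fin N))‖ ^ 2 = ∑ κ, ‖∑' m, a (κ, m)‖ ^ 2 :=
    EuclideanSpace.norm_sq_eq _
  rw [← hv, hcoord] at hnorm
  have htail := sum_norm_sq_tsum_le ha hb.summable hw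
  rw [hb.tsum_eq] at htail
  refine abs_le_of_sq_le_sq' ?_ (mul_nonneg (Real.sqrt_nonneg _) (mul_nonneg (by positivity)
    (torusL2Norm_nonneg _))) |>.2
  rw [hnorm, mul_pow, Real.sq_sqrt (by positivity)]
  calc _ ≤ (N : ℝ) ^ d * ((L ^ d)⁻¹ * torusL2Norm L (iteratedLaplacian (s + 1) f) ^ 2 *
        (1 / 16 * ((L / N) ^ (2 * s)) ^ 2)) := by
        gcongr
        refine htail.trans ?_
        gcongr
        exact sq_inv_pow_mul_le hL hN hs
    _ = _ := by
        generalize (L / N) ^ (2 * s) = X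
        rw [div_pow, div_eq_mul_inv]
        ring

end WavefunctionFlow
end

/-! ### Lower bound for the norm of a sampled function. -/

noncomputable section

namespace WavefunctionFlow

open Filter Matrix
open scoped Topology ComplexConjugate

variable {d N s : ℕ} {L : ℝ}

/-- The surplus factor `(L/N)²` of the exponent `s + 1` is discarded using `L/N ≤ 1`. -/
theorem sq_inv_pow_succ_le {D : ℝ} (hL : 0 < L) (hN : 0 < N) (hD : 0 ≤ D)
    (hDs : D * (L / N) ^ (2 * s) ≤ 1 / 3) (hLN : L / N ≤ 1) :
    (D * (((Real.pi * N / L) ^ 2)⁻¹) ^ (s + 1)) ^ 2 ≤ 1 / 9 * (1 / Real.pi ^ (4 * s)) := by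
  have hN' : (0 : ℝ) < N := by exact_mod_cast hN
  have hpi := Real.pi_pos
  have e1 : D * (((Real.pi * N / L) ^ 2)⁻¹) ^ (s + 1) =
      D * (L / N) ^ (2 * s) * ((L / N) ^ 2 * (1 / Real.pi ^ (2 * (s + 1)))) := by
    have : ((Real.pi * N / L) ^ 2)⁻¹ = (L / N) ^ 2 * (1 / Real.pi ^ 2) := by field_simp
    rw [this, mul_pow, pow_succ, ← pow_mul, div_pow 1, one_pow, ← pow_mul]
    ring
  have h2 : (L / N) ^ 2 * (1 / Real.pi ^ (2 * (s + 1))) ≤ 1 * (1 / Real.pi ^ (2 * s)) := by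
    have hLN0 : 0 ≤ L / N := by positivity
    apply mul_le_mul (pow_le_one₀ hLN0 hLN) _ (by positivity) zero_le_one
    apply one_div_le_one_div_of_le (by positivity)
    exact pow_le_pow_right₀ (by linarith [Real.pi_gt_three]) (by omega)
  have h3 : D * (((Real.pi * N / L) ^ 2)⁻¹) ^ (s + 1) ≤ 1 / 3 * (1 * (1 / Real.pi ^ (2 * s))) := by
    rw [e1]
    exact mul_le_mul hDs h2 (by positivity) (by norm_num)
  calc _ ≤ (1 / 3 * (1 * (1 / Real.pi ^ (2 * s)))) ^ 2 :=
        pow_le_pow_left₀ (by positivity) h3 2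
    _ = _ := by
        rw [show 4 * s = 2 * s * 2 by ring, pow_mul Real.pi (2 * s) 2]
        field_simp
        norm_num

/-- On a fine enough grid the sampled function keeps at least half of its norm. -/
theorem norm_gridVector_ge {f : EuclideanSpace ℝ (Fin d) → ℝ} (hL : 0 < L)
    (hs : d + 7 ≤ 4 * s) (hN : 0 < N) (hf : IsTorusCk L (2 * (s + 1)) f)
    (hf1 : ∫ x in cube d L, |f x| ^ 2 = 1)
    (hD : torusL2Norm L (iteratedLaplacian (s + 1) f) * (L / N) ^ (2 * s) ≤ 1 / 3)
    (hLN : L / N ≤ 1) :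
    √((N / L) ^ d) / 2 ≤ ‖gridVector N L f‖ := by
  have hpi := Real.pi_pos
  have hN' : (0 : ℝ) < N := by exact_mod_cast hN
  have hy : 0 < (Real.pi * N / L) ^ 2 := by positivity
  set D := torusL2Norm L (iteratedLaplacian (s + 1) f) with hDdef
  set y := (Real.pi * N / L) ^ 2 with hydef
  have hsum := summable_norm_fCoeff hL hs hf
  let a : (Fin d → Fin N) × (Fin d → ℤ) → ℂ := fun q => fCoeff L f (aliasIndex N q)
  -- The coefficients outside the Brillouin zone. They are estimated twice: summed over aliases, to
  -- control folding into the zone, and in `ℓ²`, to control the mass missing from the zone.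
  let a' : (Fin d → Fin N) × (Fin d → ℤ) → ℂ := fun q => if q.2 = 0 then 0 else a q
  have h2 : HasSum (fun q => a q • gridMode N (aliasIndex N q)) (gridVector N L f) :=
    ((aliasEquiv d hN).hasSum_iff (f := fun k => fCoeff L f k • gridMode N k)).2
      (hasSum_gridVector hL hf.1 hf.2.continuous hsum.of_norm)
  have hasum : Summable fun q => ‖a q‖ :=
    ((aliasEquiv d hN).summable_iff (f := fun k => ‖fCoeff L f k‖)).2 hsum
  have hasq : HasSum (fun q => ‖a q‖ ^ 2) (L ^ d)⁻¹ := by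
    have := hasSum_sq_fCoeff hL hf.1 hf.2.continuous
    rw [hf1, mul_one] at this
    exact ((aliasEquiv d hN).hasSum_iff (f := fun k => ‖fCoeff L f k‖ ^ 2)).2 this
  let b : (Fin d → Fin N) × (Fin d → ℤ) → ℝ := fun q =>
    ((2 * Real.pi / L) ^ 2 * nsq (aliasIndex N q)) ^ (s + 1) * ‖a q‖
  have hb : HasSum (fun q => b q ^ 2) ((L ^ d)⁻¹ * D ^ 2) :=
    ((aliasEquiv d hN).hasSum_iff
      (f := fun k => (((2 * Real.pi / L) ^ 2 * nsq k) ^ (s + 1) * ‖fCoeff L f k‖) ^ 2)).2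
      (hasSum_sq_fCoeff_iteratedLaplacian hL hf)
  have hs0 : s ≠ 0 := by omega
  have hb0 : ∀ q, 0 ≤ b q := fun q =>
    mul_nonneg (pow_nonneg (mul_nonneg (by positivity) (nsq_nonneg _)) _) (norm_nonneg _)
  -- the aliased coefficients
  have hpt : ∀ q : (Fin d → Fin N) × (Fin d → ℤ), q.2 ≠ 0 →
      ‖a q‖ ≤ b q * (y⁻¹ ^ (s + 1) * (nsq q.2)⁻¹ ^ (s + 1)) := by
    rintro ⟨κ, m⟩ hm
    have h1 := one_le_nsq hm
    have h3 := two_pi_div_sq_mul_nsq_alias_ge hL κ m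
    rw [← mul_pow, ← mul_inv, inv_pow]
    have h4 : (y * nsq m) ^ (s + 1) ≤
        ((2 * Real.pi / L) ^ 2 * nsq (aliasIndex N (κ, m))) ^ (s + 1) :=
      pow_le_pow_left₀ (by positivity) h3 _
    rw [← div_eq_mul_inv, le_div_iff₀ (by positivity), mul_comm]
    exact mul_le_mul_of_nonneg_right h4 (norm_nonneg _)
  have hpt1 : ∀ q, ‖a' q‖ ≤ b q * (y⁻¹ ^ (s + 1) * latticeWeight s q.2) := by
    intro q
    by_cases hq : q.2 = 0
    · simp [a', hq, latticeWeight, nsq, hs0]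
    · simp only [a', hq, if_false]
      refine (hpt q hq).trans ?_
      have h1 : (nsq q.2)⁻¹ ≤ 1 := inv_le_one_of_one_le₀ (one_le_nsq hq)
      have h0 : 0 ≤ (nsq q.2)⁻¹ := inv_nonneg.2 (nsq_nonneg _)
      apply mul_le_mul_of_nonneg_left _ (hb0 q)
      apply mul_le_mul_of_nonneg_left _ (by positivity)
      exact pow_le_pow_of_le_one h0 h1 (Nat.le_succ s)
  have hpt2 : ∀ q, ‖a' q‖ ^ 2 ≤ (y⁻¹ ^ (s + 1)) ^ 2 * b q ^ 2 := by
    intro q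
    rw [← mul_pow, mul_comm]
    apply pow_le_pow_left₀ (norm_nonneg _)
    by_cases hq : q.2 = 0
    · simp only [a', hq, if_true, norm_zero]
      exact mul_nonneg (hb0 q) (by positivity)
    · simp only [a', hq, if_false]
      refine (hpt q hq).trans ?_
      apply mul_le_mul_of_nonneg_left _ (hb0 q)
      apply mul_le_of_le_one_right (by positivity)
      exact pow_le_one₀ (inv_nonneg.2 (nsq_nonneg _)) (inv_le_one_of_one_le₀ (one_le_nsq hq))
  have hw : Summable fun m : Fin d → ℤ => (y⁻¹ ^ (s + 1) * latticeWeight s m) ^ 2 := by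
    simp_rw [mul_pow _ (latticeWeight s _)]
    exact (summable_sq_latticeWeight hs).mul_left _
  have hεs : (D * y⁻¹ ^ (s + 1)) ^ 2 ≤ 1 / 9 * (1 / Real.pi ^ (4 * s)) :=
    sq_inv_pow_succ_le hL hN (torusL2Norm_nonneg _) hD hLN
  have hpis : 0 < Real.pi ^ (4 * s) := by positivity
  have h3s := two_mul_three_pow_le hs
  have hLd : 0 < (L ^ d)⁻¹ := by positivity
  have htail := sum_norm_sq_tsum_le hpt1 hb.summable hw
  -- The constant is `1/9 · 1/16 = (1/12)²`; the powers of `π` cancel.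
  have htail' : ∑ κ, ‖∑' m, a' (κ, m)‖ ^ 2 ≤ (L ^ d)⁻¹ * (1 / 12) ^ 2 := by
    refine htail.trans ?_
    simp_rw [mul_pow _ (latticeWeight s _)]
    rw [hb.tsum_eq, tsum_mul_left]
    calc _ = (L ^ d)⁻¹ * ((D * y⁻¹ ^ (s + 1)) ^ 2 * ∑' m : Fin d → ℤ, latticeWeight s m ^ 2) := by
          ring
      _ ≤ (L ^ d)⁻¹ * (1 / 9 * (1 / Real.pi ^ (4 * s)) * (1 / 16 * Real.pi ^ (4 * s))) := by
          apply mul_le_mul_of_nonneg_left _ hLd.le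
          exact mul_le_mul hεs ((tsum_sq_latticeWeight_le hs).trans h3s)
            (tsum_nonneg fun _ => sq_nonneg _) (by positivity)
      _ = _ := by field_simp; norm_num
  have ha'sq : Summable fun q => ‖a' q‖ ^ 2 :=
    Summable.of_nonneg_of_le (fun _ => sq_nonneg _) hpt2 (hb.summable.mul_left _)
  have ha'sum : ∑' q, ‖a' q‖ ^ 2 ≤ (L ^ d)⁻¹ * (1 / 9) := by
    refine (ha'sq.tsum_le_tsum hpt2 (hb.summable.mul_left _)).trans ?_
    rw [tsum_mul_left, hb.tsum_eq]
    calc _ = (L ^ d)⁻¹ * (D * y⁻¹ ^ (s + 1)) ^ 2 := by ring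
      _ ≤ (L ^ d)⁻¹ * (1 / 9) := by
          apply mul_le_mul_of_nonneg_left _ hLd.le
          refine hεs.trans ?_
          have : 1 / Real.pi ^ (4 * s) ≤ 1 := by
            rw [div_le_one hpis]
            exact one_le_pow₀ (by linarith [Real.pi_gt_three])
          linarith
  -- splitting off the Brillouin zone
  have ha'summable : Summable fun q => ‖a' q‖ := by
    refine Summable.of_nonneg_of_le (fun _ => norm_nonneg _) (fun q => ?_) hasum
    simp only [a']
    split_ifs <;> simp
  have hsplit : ∀ κ, ∑' m, a (κ, m) = a (κ, 0) + ∑' m, a' (κ, m) := by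
    intro κ
    have hs' := hasum.of_norm.prod_factor κ
    rw [hs'.tsum_eq_add_tsum_ite 0]
  have hzone : ∑ κ, ‖a (κ, 0)‖ ^ 2 = (L ^ d)⁻¹ - ∑' q, ‖a' q‖ ^ 2 := by
    rw [eq_sub_iff_add_eq, ← hasq.tsum_eq, ha'sq.tsum_prod, hasq.summable.tsum_prod, tsum_fintype,
      tsum_fintype, ← Finset.sum_add_distrib]
    refine Finset.sum_congr rfl fun κ _ => ?_
    rw [(hasq.summable.prod_factor κ).tsum_eq_add_tsum_ite 0]
    congr 1
    refine tsum_congr fun m => ?_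
    simp only [a']
    split_ifs <;> simp
  let A : EuclideanSpace ℂ (Fin d → Fin N) := WithLp.toLp 2 fun κ => ∑' m, a (κ, m)
  let A₀ : EuclideanSpace ℂ (Fin d → Fin N) := WithLp.toLp 2 fun κ => a (κ, 0)
  let A₁ : EuclideanSpace ℂ (Fin d → Fin N) := WithLp.toLp 2 fun κ => ∑' m, a' (κ, m)
  have hA : A = A₀ + A₁ := by
    ext κ
    exact hsplit κ
  have hA₁ : ‖A₁‖ ≤ √(L ^ d)⁻¹ * (1 / 12) := by
    refine abs_le_of_sq_le_sq' ?_ (by positivity) |>.2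
    rw [mul_pow, Real.sq_sqrt hLd.le, EuclideanSpace.norm_sq_eq]
    exact htail'
  -- By Parseval the zone carries at least `1 - 1/9 = 8/9` of the mass, more than the `(2/3)²`
  -- needed. Below, `2/3 - 1/12 ≥ 1/2`.
  have hA₀ : √(L ^ d)⁻¹ * (2 / 3) ≤ ‖A₀‖ := by
    refine abs_le_of_sq_le_sq' ?_ (norm_nonneg _) |>.2
    rw [mul_pow, Real.sq_sqrt hLd.le, EuclideanSpace.norm_sq_eq]
    change _ ≤ ∑ κ, ‖a (κ, 0)‖ ^ 2
    rw [hzone]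
    linarith
  have hAge : √(L ^ d)⁻¹ * (1 / 2) ≤ ‖A‖ := by
    have := norm_sub_le_norm_add A₀ A₁
    rw [hA]
    have h0 : 0 ≤ √(L ^ d)⁻¹ := Real.sqrt_nonneg _
    linarith
  have hv := eq_sum_tsum_smul_gridMode hasum h2
  have hnorm := norm_sq_sum_smul_gridMode hN A
  simp only [A] at hnorm
  rw [← hv] at hnorm
  refine abs_le_of_sq_le_sq' ?_ (norm_nonneg _) |>.2
  rw [hnorm, div_pow, Real.sq_sqrt (by positivity), div_pow]
  have h5 : (√(L ^ d)⁻¹ * (1 / 2)) ^ 2 ≤ ‖A‖ ^ 2 := pow_le_pow_left₀ (by positivity) hAge 2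
  rw [mul_pow, Real.sq_sqrt hLd.le] at h5
  calc _ = (N : ℝ) ^ d * ((L ^ d)⁻¹ * (1 / 2) ^ 2) := by field_simp
    _ ≤ _ := mul_le_mul_of_nonneg_left h5 (by positivity)

end WavefunctionFlow
end

/-! ### Time derivative of `√p` and stability of skew-adjoint evolutions. -/

noncomputable section

namespace WavefunctionFlow

open Filter Matrix Set
open scoped Topology ComplexConjugate

variable {d N s : ℕ} {L : ℝ}

theorem sqrt_sq_add_sq_le {a η : ℝ} (ha : 0 ≤ a) (hη : 0 ≤ η) : √(a ^ 2 + η ^ 2) ≤ a + η := by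
  rw [Real.sqrt_le_left (by positivity)]
  nlinarith [mul_nonneg ha hη]

/-- The square root of a nonnegative solution of `p' = 2 √p g` solves `(√p)' = g`, provided `g`
vanishes at the zeros of `p`. -/
theorem hasDerivWithinAt_sqrt_of_eq {T : ℝ} {p g : ℝ → ℝ} (hp : ∀ t ∈ Icc 0 T, 0 ≤ p t)
    (hg : ContinuousOn g (Icc 0 T)) (hg0 : ∀ t ∈ Icc 0 T, p t = 0 → g t = 0)
    (hder : ∀ t ∈ Icc 0 T, HasDerivWithinAt p (2 * √(p t) * g t) (Icc 0 T) t) {t : ℝ}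
    (ht : t ∈ Icc 0 T) : HasDerivWithinAt (fun τ => √(p τ)) (g t) (Icc 0 T) t := by
  by_cases h0 : p t = 0
  · rw [hg0 t ht h0, hasDerivWithinAt_iff_isLittleO, Asymptotics.isLittleO_iff]
    intro ε hε
    have hnear : ∀ᶠ τ in 𝓝[Icc 0 T] t, |g τ| < ε := by
      have := (hg t ht).abs
      rw [ContinuousWithinAt, hg0 t ht h0, abs_zero] at this
      exact this.eventually_lt_const hε
    obtain ⟨r, hr, hball⟩ := Metric.mem_nhdsWithin_iff.1 hnear
    have hself : Metric.ball t r ∩ Icc 0 T ∈ 𝓝[Icc 0 T] t :=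
      inter_mem (mem_nhdsWithin_of_mem_nhds (Metric.ball_mem_nhds t hr)) self_mem_nhdsWithin
    filter_upwards [hself] with y hy
    -- The regularized root `√(p + η²)` is differentiable even at zeros of `p`, and its derivative
    -- `√p g / √(p + η²)` is at most `|g| < ε` in absolute value, uniformly in `η`. The mean value
    -- inequality then survives `η → 0`.
    have hbound : ∀ η > 0, |√(p y + η ^ 2) - η| ≤ ε * |y - t| := by
      intro η hη
      have h1 := (((convex_ball t r).inter (convex_Icc 0 T))).norm_image_sub_le_of_norm_hasDerivWithin_le
        (f := fun τ => √(p τ + η ^ 2)) (f' := fun τ => 2 * √(p τ) * g τ / (2 * √(p τ + η ^ 2)))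
        (C := ε) (x := t) (y := y)
        (fun τ hτ => by
          have hpτ := hp τ hτ.2
          exact (((hder τ hτ.2).mono inter_subset_right).add_const (η ^ 2)).sqrt (by positivity))
        (fun τ hτ => by
          have hpτ := hp τ hτ.2
          have hle : √(p τ) ≤ √(p τ + η ^ 2) := Real.sqrt_le_sqrt (by nlinarith)
          have hpos : 0 < √(p τ + η ^ 2) := Real.sqrt_pos.2 (by positivity)
          have hgτ : |g τ| < ε := hball hτ
          rw [Real.norm_eq_abs, abs_div, abs_mul, abs_of_nonneg (a := 2 * √(p τ)) (by positivity),
            abs_of_nonneg (a := 2 * √(p τ + η ^ 2)) (by positivity), div_le_iff₀ (by positivity)]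
          have := mul_le_mul hle hgτ.le (abs_nonneg _) hpos.le
          nlinarith)
        ⟨Metric.mem_ball_self hr, ht⟩ hy
      simpa [h0, Real.sqrt_sq hη.le] using h1
    have hlim : |√(p y)| ≤ ε * |y - t| := by
      have hcont : Tendsto (fun η : ℝ => |√(p y + η ^ 2) - η|) (𝓝[>] 0) (𝓝 |√(p y)|) := by
        have : Continuous fun η : ℝ => |√(p y + η ^ 2) - η| := by fun_prop
        have h2 := this.tendsto 0
        simp only [ne_eq, OfNat.ofNat_ne_zero, not_false_eq_true, zero_pow, add_zero,
          sub_zero] at h2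
        exact h2.mono_left nhdsWithin_le_nhds
      exact le_of_tendsto hcont (eventually_mem_nhdsWithin.mono fun η hη => hbound η hη)
    simpa [h0] using hlim
  · have hpos : 0 < √(p t) := Real.sqrt_pos.2 (lt_of_le_of_ne (hp t ht) (Ne.symm h0))
    have := (hder t ht).sqrt h0
    convert! this using 1
    field_simp

section Stability

variable {E : Type*} [NormedAddCommGroup E] [InnerProductSpace ℝ E]

/-- Norm growth for a skew-adjoint linear evolution with an inhomogeneity. -/
theorem norm_le_of_hasDerivWithinAt_skew {T ε : ℝ} (hT : 0 ≤ T) {w r : ℝ → E}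
    {A : ℝ → E →ₗ[ℝ] E} (hA : ∀ t ∈ Icc 0 T, ∀ x, inner ℝ x (A t x) = 0)
    (hw : ∀ t ∈ Icc 0 T, HasDerivWithinAt w (A t (w t) + r t) (Icc 0 T) t)
    (hr : ∀ t ∈ Icc 0 T, ‖r t‖ ≤ ε) : ‖w T‖ ≤ ‖w 0‖ + T * ε := by
  refine le_of_forall_pos_le_add fun η hη => ?_
  -- The `η²` keeps the norm differentiable where `w` vanishes; `η` is arbitrary and disappears at
  -- the end.
  let h : ℝ → ℝ := fun t => √(‖w t‖ ^ 2 + η ^ 2) - t * ε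
  have hder : ∀ t ∈ Icc 0 T, HasDerivWithinAt h
      (2 * inner ℝ (w t) (A t (w t) + r t) / (2 * √(‖w t‖ ^ 2 + η ^ 2)) - 1 * ε) (Icc 0 T) t := by
    intro t ht
    exact ((((hw t ht).norm_sq).add_const (η ^ 2)).sqrt (by positivity)).sub
      ((hasDerivWithinAt_id t _).mul_const ε)
  have hanti : AntitoneOn h (Icc 0 T) := by
    refine antitoneOn_of_hasDerivWithinAt_nonpos (convex_Icc 0 T)
      (fun t ht => (hder t ht).continuousWithinAt)
      (fun t ht => (hder t (interior_subset ht)).mono interior_subset) fun t ht => ?_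
    have ht' := interior_subset ht
    rw [inner_add_right, hA t ht', zero_add, one_mul, sub_nonpos]
    have hpos : 0 < √(‖w t‖ ^ 2 + η ^ 2) := Real.sqrt_pos.2 (by positivity)
    rw [div_le_iff₀ (by positivity)]
    have h1 : inner ℝ (w t) (r t) ≤ ‖w t‖ * ‖r t‖ := real_inner_le_norm _ _
    have h2 : ‖w t‖ ≤ √(‖w t‖ ^ 2 + η ^ 2) := Real.le_sqrt_of_sq_le (by nlinarith)
    have h3 := mul_le_mul h2 (hr t ht') (norm_nonneg _) hpos.le
    linarith
  have h1 := hanti (left_mem_Icc.2 hT) (right_mem_Icc.2 hT) hT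
  simp only [h, zero_mul, sub_zero] at h1
  have h2 : ‖w T‖ ≤ √(‖w T‖ ^ 2 + η ^ 2) := Real.le_sqrt_of_sq_le (by nlinarith)
  have h3 := sqrt_sq_add_sq_le (norm_nonneg (w 0)) hη.le
  linarith

/-- The normalization of an almost skew-adjoint evolution is again an almost skew-adjoint
evolution. -/
theorem norm_normalized_sub_le {T ε : ℝ} (hT : 0 ≤ T) {u e φ : ℝ → E}
    {A : ℝ → E →ₗ[ℝ] E} (hA : ∀ t ∈ Icc 0 T, ∀ x, inner ℝ x (A t x) = 0)
    (hu : ∀ t ∈ Icc 0 T, HasDerivWithinAt u (A t (u t) + e t) (Icc 0 T) t)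
    (hφ : ∀ t ∈ Icc 0 T, HasDerivWithinAt φ (A t (φ t)) (Icc 0 T) t)
    (hu0 : ∀ t ∈ Icc 0 T, u t ≠ 0) (he : ∀ t ∈ Icc 0 T, ‖e t‖ ≤ ε * ‖u t‖) :
    ‖‖u T‖⁻¹ • u T - φ T‖ ≤ ‖‖u 0‖⁻¹ • u 0 - φ 0‖ + T * (2 * ε) := by
  -- Skew-adjointness of `A` means that only `e` changes `‖u‖`. So `u/‖u‖` again evolves under `A`,
  -- with `r` as remainder; bounding its two terms separately gives `2 * ε`.
  refine norm_le_of_hasDerivWithinAt_skew (w := fun t => ‖u t‖⁻¹ • u t - φ t)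
    (r := fun t => ‖u t‖⁻¹ • e t - (inner ℝ (u t) (e t) / ‖u t‖ ^ 3) • u t) hT hA ?_ ?_
  · intro t ht
    have hn : 0 < ‖u t‖ := norm_pos_iff.2 (hu0 t ht)
    have h1 : HasDerivWithinAt (fun τ => ‖u τ‖) (inner ℝ (u t) (e t) / ‖u t‖) (Icc 0 T) t := by
      have h2 := ((hu t ht).norm_sq).sqrt (by positivity)
      simp only [Real.sqrt_sq (norm_nonneg _)] at h2
      convert! h2 using 1
      rw [inner_add_right, hA t ht, zero_add]
      field_simp
    have h3 := ((h1.inv hn.ne').smul (hu t ht)).sub (hφ t ht)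
    convert! h3 using 1
    simp only [map_sub, map_smul, smul_add, Pi.inv_apply]
    have : -(inner ℝ (u t) (e t) / ‖u t‖) / ‖u t‖ ^ 2 = -(inner ℝ (u t) (e t) / ‖u t‖ ^ 3) := by
      field_simp
    rw [this, neg_smul]
    abel
  · intro t ht
    have hn : 0 < ‖u t‖ := norm_pos_iff.2 (hu0 t ht)
    have h1 : ‖‖u t‖⁻¹ • e t‖ ≤ ε := by
      rw [norm_smul, norm_inv, norm_norm, inv_mul_le_iff₀ hn, mul_comm]
      exact he t ht
    have h2 : ‖(inner ℝ (u t) (e t) / ‖u t‖ ^ 3) • u t‖ ≤ ε := by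
      rw [norm_smul, norm_div, norm_pow, norm_norm, div_mul_eq_mul_div, div_le_iff₀ (by positivity)]
      have h3 : ‖inner ℝ (u t) (e t)‖ ≤ ‖u t‖ * ‖e t‖ := norm_inner_le_norm _ _
      have h4 := mul_le_mul_of_nonneg_left (he t ht) hn.le
      calc _ ≤ ‖u t‖ * (ε * ‖u t‖) * ‖u t‖ := by
            apply mul_le_mul_of_nonneg_right (h3.trans h4) hn.le
        _ = _ := by ring
    calc _ ≤ _ := norm_sub_le _ _
      _ ≤ 2 * ε := by linarith

end Stability

section Calculus

theorem pderiv_mul {f g : EuclideanSpace ℝ (Fin d) → ℝ} {x : EuclideanSpace ℝ (Fin d)}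
    (hf : DifferentiableAt ℝ f x) (hg : DifferentiableAt ℝ g x) (i : Fin d) :
    pderiv i (fun y => f y * g y) x = pderiv i f x * g x + f x * pderiv i g x := by
  unfold pderiv
  rw [fderiv_fun_mul hf hg]
  simp
  ring

theorem pderiv_add {f g : EuclideanSpace ℝ (Fin d) → ℝ} {x : EuclideanSpace ℝ (Fin d)}
    (hf : DifferentiableAt ℝ f x) (hg : DifferentiableAt ℝ g x) (i : Fin d) :
    pderiv i (fun y => f y + g y) x = pderiv i f x + pderiv i g x := by
  unfold pderiv
  rw [fderiv_fun_add hf hg]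
  rfl

theorem gradient_apply (f : EuclideanSpace ℝ (Fin d) → ℝ) (x : EuclideanSpace ℝ (Fin d))
    (i : Fin d) : gradient f x i = pderiv i f x := by
  have h : inner ℝ (gradient f x) (EuclideanSpace.single i (1 : ℝ)) = pderiv i f x := by
    rw [gradient, InnerProductSpace.toDual_symm_apply]
    rfl
  rw [← h, EuclideanSpace.inner_single_right]
  simp

variable {q V : EuclideanSpace ℝ (Fin d) → ℝ}

theorem differentiable_pderiv (hq : ContDiff ℝ 2 q) (i : Fin d) :
    Differentiable ℝ (pderiv i q) :=
  (contDiff_pderiv (n := 2) (m := 1) hq le_rfl i).differentiable one_ne_zero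

/-- The time derivative of `√p` under the continuity equation. -/
def flowRate (V q : EuclideanSpace ℝ (Fin d) → ℝ) (x : EuclideanSpace ℝ (Fin d)) : ℝ :=
  -(1 / 2) * Laplacian.laplacian (fun y => V y * q y) x + 1 / 2 * (V x * Laplacian.laplacian q x)

/-- The terms `V Δq` cancel, so the rate is first order in `q`. This form matches the continuity
equation and shows the vanishing at zeros of `q`. -/
theorem flowRate_eq (hV : ContDiff ℝ 2 V) (hq : ContDiff ℝ 2 q) (x : EuclideanSpace ℝ (Fin d)) :
    flowRate V q x =
      -∑ i, (pderiv i q x * pderiv i V x + 1 / 2 * (q x * pderiv i (pderiv i V) x)) := by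
  have hVd : Differentiable ℝ V := hV.differentiable two_ne_zero
  have hqd : Differentiable ℝ q := hq.differentiable two_ne_zero
  have hVd' := differentiable_pderiv hV
  have hqd' := differentiable_pderiv hq
  rw [flowRate, laplacian_eq_sum_pderiv (hV.mul hq), laplacian_eq_sum_pderiv hq]
  simp only [Finset.mul_sum, ← Finset.sum_neg_distrib, ← Finset.sum_add_distrib]
  refine Finset.sum_congr rfl fun i _ => ?_
  have e : pderiv i (fun y => V y * q y) = fun y => pderiv i V y * q y + V y * pderiv i q y :=
    funext fun y => pderiv_mul (hVd y) (hqd y) i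
  have e2 : pderiv i (fun y => pderiv i V y * q y + V y * pderiv i q y) x =
      pderiv i (fun y => pderiv i V y * q y) x + pderiv i (fun y => V y * pderiv i q y) x :=
    pderiv_add ((hVd' i x).mul (hqd x)) ((hVd x).mul (hqd' i x)) i
  rw [e, e2, pderiv_mul (hVd' i x) (hqd x), pderiv_mul (hVd x) (hqd' i x)]
  ring

theorem neg_divergence_eq (hV : ContDiff ℝ 2 V) (hq : ContDiff ℝ 2 q)
    (x : EuclideanSpace ℝ (Fin d)) :
    -divergence (fun y => (q y * q y) • gradient V y) x = 2 * q x * flowRate V q x := by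
  have hqd : Differentiable ℝ q := hq.differentiable two_ne_zero
  have hVd' := differentiable_pderiv hV
  rw [flowRate_eq hV hq, divergence]
  simp only [PiLp.smul_apply, gradient_apply, smul_eq_mul]
  rw [mul_neg, Finset.mul_sum]
  congr 1
  refine Finset.sum_congr rfl fun i _ => ?_
  have h := pderiv_mul ((hqd x).mul (hqd x)) (hVd' i x) i
  change pderiv i (fun y => q y * q y * pderiv i V y) x = _
  refine h.trans ?_
  change pderiv i (fun y => q y * q y) x * _ + q x * q x * _ = _
  rw [pderiv_mul (hqd x) (hqd x)]
  ring

/-- A zero of the nonnegative function `q` is a minimum, so its gradient vanishes there too. -/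
theorem flowRate_eq_zero (hV : ContDiff ℝ 2 V) (hq : ContDiff ℝ 2 q) (hq0 : ∀ x, 0 ≤ q x)
    {x : EuclideanSpace ℝ (Fin d)} (hx : q x = 0) : flowRate V q x = 0 := by
  have hmin : IsLocalMin q x := Eventually.of_forall fun y => by rw [hx]; exact hq0 y
  have h0 : ∀ i, pderiv i q x = 0 := fun i => by
    unfold pderiv
    rw [hmin.fderiv_eq_zero]
    rfl
  rw [flowRate_eq hV hq]
  simp [h0, hx]

theorem hasDerivWithinAt_sqrtFun {T : ℝ} {p V : ℝ → EuclideanSpace ℝ (Fin d) → ℝ}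
    (hp : ∀ t ∈ Icc 0 T, ∀ x, 0 ≤ p t x) (hcont : ContinuityEquation T p V)
    (hpC : ∀ t ∈ Icc 0 T, ContDiff ℝ 2 (sqrtFun (p t))) (hVC : ∀ t ∈ Icc 0 T, ContDiff ℝ 2 (V t))
    (hVt : ∀ x, ContinuousOn (fun t => V t x) (Icc 0 T))
    (hpt : ∀ x, ContinuousOn (fun t => Laplacian.laplacian (sqrtFun (p t)) x) (Icc 0 T))
    (hVpt : ∀ x, ContinuousOn
      (fun t => Laplacian.laplacian (fun y => V t y * sqrtFun (p t) y) x) (Icc 0 T))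
    {t : ℝ} (ht : t ∈ Icc 0 T) (x : EuclideanSpace ℝ (Fin d)) :
    HasDerivWithinAt (fun τ => sqrtFun (p τ) x) (flowRate (V t) (sqrtFun (p t)) x)
      (Icc 0 T) t := by
  refine hasDerivWithinAt_sqrt_of_eq (p := fun τ => p τ x)
    (g := fun τ => flowRate (V τ) (sqrtFun (p τ)) x) (fun τ hτ => hp τ hτ x) ?_ ?_ ?_ ht
  -- The three assumptions of continuity in time serve exactly to make the rate continuous in time.
  · exact (continuousOn_const.mul (hVpt x)).add
      (continuousOn_const.mul ((hVt x).mul (hpt x)))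
  · intro τ hτ h0
    exact flowRate_eq_zero (hVC τ hτ) (hpC τ hτ) (fun _ => Real.sqrt_nonneg _)
      (by simp [sqrtFun, h0])
  · intro τ hτ
    have h1 := neg_divergence_eq (hVC τ hτ) (hpC τ hτ) x
    have h2 : (fun y => (sqrtFun (p τ) y * sqrtFun (p τ) y) • gradient (V τ) y) =
        fun y => p τ y • gradient (V τ) y := by
      funext y
      rw [sqrtFun, Real.mul_self_sqrt (hp τ hτ y)]
    rw [h2] at h1
    have h3 := hcont τ hτ x
    rw [h1] at h3
    exact h3

end Calculus

end WavefunctionFlow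
end

/-! ### The discrete generator and the defect of the sampled wavefunction. -/

noncomputable section

namespace WavefunctionFlow

open Filter Matrix Set
open scoped Topology ComplexConjugate

variable {d N s : ℕ} {L : ℝ}

theorem gridPoint_mem_cube (hL : 0 < L) (j : Fin d → Fin N) : gridPoint L j ∈ cube d L := by
  intro i
  have hN : (0 : ℝ) < N := by exact_mod_cast (j i).pos
  have h1 : ((j i : ℕ) : ℝ) ≤ N := by exact_mod_cast (j i).2.le
  simp only [gridPoint]
  constructor
  · positivity
  · rw [div_mul_eq_mul_div, div_le_iff₀ hN]
    exact mul_le_mul_of_nonneg_left h1 hL.le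

theorem abs_le_torusSupNorm {V : EuclideanSpace ℝ (Fin d) → ℝ} (hL : 0 < L)
    (hV : IsTorusPeriodic L V) (hc : Continuous V) {x : EuclideanSpace ℝ (Fin d)}
    (hx : x ∈ cube d L) : |V x| ≤ torusSupNorm L V := by
  obtain ⟨C, hC⟩ := hV.exists_bound hL hc
  refine le_csSup ⟨C, ?_⟩ (mem_image_of_mem _ hx)
  rintro _ ⟨y, -, rfl⟩
  exact hC y

theorem torusSupNorm_nonneg (V : EuclideanSpace ℝ (Fin d) → ℝ) : 0 ≤ torusSupNorm L V := by
  apply Real.sSup_nonneg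
  rintro _ ⟨y, -, rfl⟩
  exact abs_nonneg _

theorem norm_matDV_le {V : EuclideanSpace ℝ (Fin d) → ℝ} (hL : 0 < L)
    (hV : IsTorusPeriodic L V) (hc : Continuous V) (v : EuclideanSpace ℂ (Fin d → Fin N)) :
    ‖Matrix.toEuclideanLin (matDV N L V) v‖ ≤ torusSupNorm L V * ‖v‖ := by
  refine abs_le_of_sq_le_sq' ?_ (mul_nonneg (torusSupNorm_nonneg V) (norm_nonneg _)) |>.2
  rw [mul_pow, EuclideanSpace.norm_sq_eq, EuclideanSpace.norm_sq_eq, Finset.mul_sum]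
  refine Finset.sum_le_sum fun j _ => ?_
  have : Matrix.toEuclideanLin (matDV N L V) v j = (V (gridPoint L j) : ℂ) * v j := by
    change (matDV N L V *ᵥ v.ofLp) j = _
    rw [matDV, Matrix.mulVec_diagonal]
  rw [this, norm_mul, mul_pow, Complex.norm_real, Real.norm_eq_abs]
  gcongr
  exact abs_le_torusSupNorm hL hV hc (gridPoint_mem_cube hL j)

theorem matDV_gridVector (V f : EuclideanSpace ℝ (Fin d) → ℝ) :
    Matrix.toEuclideanLin (matDV N L V) (gridVector N L f) =
      gridVector N L (fun x => V x * f x) := by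
  ext j
  change (matDV N L V *ᵥ fun j => (f (gridPoint L j) : ℂ)) j = _
  rw [matDV, Matrix.mulVec_diagonal]
  simp [gridVector]

/-- The generator `-i H` of the discrete evolution, as a real-linear map. -/
def discreteGenerator (N : ℕ) (L : ℝ) (V : EuclideanSpace ℝ (Fin d) → ℝ) :
    EuclideanSpace ℂ (Fin d → Fin N) →ₗ[ℝ] EuclideanSpace ℂ (Fin d → Fin N) :=
  (-Complex.I • Matrix.toEuclideanLin (discreteHamiltonian N L V)).restrictScalars ℝ

theorem discreteGenerator_apply (V : EuclideanSpace ℝ (Fin d) → ℝ)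
    (v : EuclideanSpace ℂ (Fin d → Fin N)) :
    discreteGenerator N L V v =
      Matrix.toEuclideanLin (matK d N L) (Matrix.toEuclideanLin (matDV N L V) v) -
        Matrix.toEuclideanLin (matDV N L V) (Matrix.toEuclideanLin (matK d N L) v) := by
  change -Complex.I • Matrix.toEuclideanLin (discreteHamiltonian N L V) v = _
  rw [discreteHamiltonian, map_smul, LinearMap.smul_apply, smul_smul, neg_mul, Complex.I_mul_I,
    neg_neg, one_smul, map_sub, LinearMap.sub_apply]
  congr 1 <;>
  · ext j
    change (_ *ᵥ _) j = (_ *ᵥ (_ *ᵥ _)) j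
    rw [Matrix.mulVec_mulVec]

theorem real_inner_eq_re (v w : EuclideanSpace ℂ (Fin d → Fin N)) :
    inner ℝ v w = (inner ℂ v w : ℂ).re := by
  rw [PiLp.inner_apply, PiLp.inner_apply, Complex.re_sum]
  rfl

/-- A Hermitian matrix has real expectation values, so multiplication by `-i` makes them purely
imaginary. -/
theorem inner_discreteGenerator (V : EuclideanSpace ℝ (Fin d) → ℝ)
    (v : EuclideanSpace ℂ (Fin d → Fin N)) : inner ℝ v (discreteGenerator N L V v) = 0 := by
  rw [real_inner_eq_re]
  change (inner ℂ v (-Complex.I • Matrix.toEuclideanLin (discreteHamiltonian N L V) v) : ℂ).re = 0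
  have hsym := Matrix.isSymmetric_toEuclideanLin_iff.2 (discreteHamiltonian_isHermitian N L V)
  have him : (inner ℂ v (Matrix.toEuclideanLin (discreteHamiltonian N L V) v) : ℂ).im = 0 := by
    have h1 := hsym v v
    rw [← Complex.conj_eq_iff_im, inner_conj_symm]
    exact h1
  rw [inner_smul_right]
  simp [him]

theorem hasDerivWithinAt_gridVector {f : ℝ → EuclideanSpace ℝ (Fin d) → ℝ}
    {f' : EuclideanSpace ℝ (Fin d) → ℝ} {S : Set ℝ} {t : ℝ}
    (h : ∀ x, HasDerivWithinAt (fun τ => f τ x) (f' x) S t) :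
    HasDerivWithinAt (fun τ => gridVector N L (f τ)) (gridVector N L f') S t := by
  have h1 : HasDerivWithinAt (fun τ => fun j : Fin d → Fin N => (f τ (gridPoint L j) : ℂ))
      (fun j => (f' (gridPoint L j) : ℂ)) S t :=
    hasDerivWithinAt_pi.2 fun j => (h (gridPoint L j)).ofReal_comp
  exact ((EuclideanSpace.equiv (Fin d → Fin N) ℂ).symm.toContinuousLinearMap.restrictScalars
    ℝ).hasFDerivAt.comp_hasDerivWithinAt t h1

/-- Since `-iH = [K, D_V]` and `D_V` acts exactly on samples, the defect contains only the two
errors `Δ + 2K`, on `Vq` and on `q`. -/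
theorem gridVector_flowRate (V q : EuclideanSpace ℝ (Fin d) → ℝ) :
    gridVector N L (flowRate V q) = discreteGenerator N L V (gridVector N L q) +
      ((-(1 / 2) : ℂ) • (gridVector N L (Laplacian.laplacian fun x => V x * q x) +
          (2 : ℂ) • Matrix.toEuclideanLin (matK d N L) (gridVector N L fun x => V x * q x)) +
        (1 / 2 : ℂ) • Matrix.toEuclideanLin (matDV N L V)
          (gridVector N L (Laplacian.laplacian q) +
            (2 : ℂ) • Matrix.toEuclideanLin (matK d N L) (gridVector N L q))) := by
  have h1 : gridVector N L (flowRate V q) =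
      (-(1 / 2) : ℂ) • gridVector N L (Laplacian.laplacian fun x => V x * q x) +
        (1 / 2 : ℂ) • gridVector N L (fun x => V x * Laplacian.laplacian q x) := by
    ext j
    simp [gridVector, flowRate]
  rw [h1, discreteGenerator_apply, matDV_gridVector, map_add, matDV_gridVector, map_smul]
  module

theorem torusSupNorm_mul_add_le {p V : EuclideanSpace ℝ (Fin d) → ℝ} :
    torusSupNorm L V * torusL2Norm L (iteratedLaplacian (s + 1) (sqrtFun p)) +
      torusL2Norm L (iteratedLaplacian (s + 1) (fun x => V x * sqrtFun p x)) ≤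
    errorDensity L s p V := by
  rw [errorDensity]
  have := torusL2Norm_nonneg (L := L) (iteratedLaplacian (s + 1) (sqrtFun p))
  linarith

theorem torusL2Norm_le_errorDensity {p V : EuclideanSpace ℝ (Fin d) → ℝ} :
    torusL2Norm L (iteratedLaplacian (s + 1) (sqrtFun p)) ≤ errorDensity L s p V := by
  rw [errorDensity]
  have h1 := torusL2Norm_nonneg (L := L) (iteratedLaplacian (s + 1) (sqrtFun p))
  have h2 := torusL2Norm_nonneg (L := L)
    (iteratedLaplacian (s + 1) (fun x => V x * sqrtFun p x))
  have h3 := mul_nonneg (torusSupNorm_nonneg (L := L) V) h1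
  linarith

/-- The defect of the sampled wavefunction in the discrete Schrödinger equation. -/
theorem norm_gridVector_flowRate_sub_le {p V : EuclideanSpace ℝ (Fin d) → ℝ} (hL : 0 < L)
    (hs : d + 7 ≤ 4 * s) (M : ℕ) (hM : N = 2 * M) (hN : 0 < N)
    (hp : IsTorusCk L (2 * (s + 1)) (sqrtFun p)) (hV : IsTorusCk L (2 * (s + 1)) V) :
    ‖gridVector N L (flowRate V (sqrtFun p)) -
        discreteGenerator N L V (gridVector N L (sqrtFun p))‖ ≤
      √((N / L) ^ d) * (1 / 8 * (L / N) ^ (2 * s) * errorDensity L s p V) := by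
  have hN' : (0 : ℝ) < N := by exact_mod_cast hN
  have hVp : IsTorusCk L (2 * (s + 1)) (fun x => V x * sqrtFun p x) :=
    ⟨fun x i => by simp only [hV.1 x i, hp.1 x i], hV.2.mul hp.2⟩
  have h1 := norm_gridVector_laplacian_add_le hL hs M hM hN hVp
  have h2 := norm_gridVector_laplacian_add_le hL hs M hM hN hp
  have h3 := (norm_matDV_le hL hV.1 hV.2.continuous (gridVector N L
    (Laplacian.laplacian (sqrtFun p)) + (2 : ℂ) • Matrix.toEuclideanLin (matK d N L)
      (gridVector N L (sqrtFun p)))).trans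
    (mul_le_mul_of_nonneg_left h2 (torusSupNorm_nonneg V))
  rw [gridVector_flowRate, add_sub_cancel_left]
  refine (norm_add_le _ _).trans ?_
  rw [norm_smul, norm_smul, norm_neg]
  have h4 : ‖(1 / 2 : ℂ)‖ = 1 / 2 := by norm_num
  rw [h4]
  have h5 : 0 ≤ √((N / L) ^ d) * (1 / 8 * (L / N) ^ (2 * s)) := by positivity
  have h6 := mul_le_mul_of_nonneg_left (torusSupNorm_mul_add_le (L := L) (s := s) (p := p) (V := V))
    h5
  linarith

theorem qsample_eq_smul (N : ℕ) (L : ℝ) (p : EuclideanSpace ℝ (Fin d) → ℝ) :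
    qsample N L p = ‖gridVector N L (sqrtFun p)‖⁻¹ • gridVector N L (sqrtFun p) := by
  rw [qsample, Complex.coe_smul]

theorem norm_qsample {p : EuclideanSpace ℝ (Fin d) → ℝ} (h : gridVector N L (sqrtFun p) ≠ 0) :
    ‖qsample N L p‖ = 1 := by
  rw [qsample_eq_smul, norm_smul, norm_inv, norm_norm, inv_mul_cancel₀ (norm_ne_zero_iff.2 h)]

theorem qsample_one {p : EuclideanSpace ℝ (Fin d) → ℝ} (h : gridVector 1 L (sqrtFun p) ≠ 0) :
    qsample 1 L p = WithLp.toLp 2 fun _ => 1 := by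
  have hj : ∀ j : Fin d → Fin 1, j = 0 := fun j => Subsingleton.elim _ _
  have hn : ‖gridVector 1 L (sqrtFun p)‖ = sqrtFun p (gridPoint L (0 : Fin d → Fin 1)) := by
    rw [EuclideanSpace.norm_eq, Fintype.sum_unique, Real.sqrt_sq (norm_nonneg _), hj default]
    simp only [gridVector, Complex.norm_real, Real.norm_eq_abs]
    exact abs_of_nonneg (Real.sqrt_nonneg _)
  have hn0 := norm_ne_zero_iff.2 h
  ext j
  rw [qsample_eq_smul, PiLp.smul_apply, hj j, hn]
  rw [hn] at hn0
  simp [gridVector, hn0]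

/-- One-by-one matrices commute. -/
theorem discreteGenerator_one (V : EuclideanSpace ℝ (Fin d) → ℝ)
    (v : EuclideanSpace ℂ (Fin d → Fin 1)) : discreteGenerator 1 L V v = 0 := by
  change -Complex.I • Matrix.toEuclideanLin (discreteHamiltonian 1 L V) v = 0
  have : discreteHamiltonian 1 L V = 0 := by
    rw [discreteHamiltonian]
    have hcomm : matK d 1 L * matDV 1 L V = matDV 1 L V * matK d 1 L := by
      ext i j
      rw [Matrix.mul_apply, Matrix.mul_apply, Fintype.sum_unique, Fintype.sum_unique,
        Subsingleton.elim i default, Subsingleton.elim j default, mul_comm]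
    rw [hcomm, sub_self, smul_zero]
  rw [this, map_zero, LinearMap.zero_apply, smul_zero]

end WavefunctionFlow
end

/-! ### Assembly of the error estimate. -/

open WavefunctionFlow in
theorem theorem1 (d : ℕ) (hd : 1 ≤ d) (L T : ℝ) (hL : 0 < L) (hT : 0 < T)
    (N : ℕ) (hN : ∃ m : ℕ, N = 2 ^ m)
    (s : ℕ) (hs : ((d : ℝ) + 7) / 4 ≤ (s : ℝ))
    (p V : ℝ → EuclideanSpace ℝ (Fin d) → ℝ)
    (hp : ∀ t ∈ Set.Icc 0 T, IsTorusPDF L (p t))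
    (hcont : ContinuityEquation T p V)
    (hpC : ∀ t ∈ Set.Icc 0 T, IsTorusCk L (2 * (s + 1)) (sqrtFun (p t)))
    (hVC : ∀ t ∈ Set.Icc 0 T, IsTorusCk L (2 * (s + 1)) (V t))
    (hVt : ∀ x, ContinuousOn (fun t => V t x) (Set.Icc 0 T))
    (hpt : ∀ x, ContinuousOn
      (fun t => Laplacian.laplacian (sqrtFun (p t)) x) (Set.Icc 0 T))
    (hVpt : ∀ x, ContinuousOn
      (fun t => Laplacian.laplacian (fun y => V t y * sqrtFun (p t) y) x) (Set.Icc 0 T))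
    (hbdd : BddAbove ((fun t => errorDensity L s (p t) (V t)) '' Set.Icc 0 T))
    (φ : ℝ → EuclideanSpace ℂ (Fin d → Fin N))
    (hφ : SolvesSchrodinger T (fun t => discreteHamiltonian N L (V t)) φ)
    (δ : ℝ)
    (hδ : δ = ‖qsample N L (p 0) - φ 0‖ +
      T * errorConst L T s p V * (L * d / N) ^ (2 * s))
    (hδT : δ ≤ T) :
    (∀ t ∈ Set.Icc 0 T, ‖qsample N L (p t)‖ = 1) ∧
      ‖qsample N L (p T) - φ T‖ ≤ δ := by
  have hs' : d + 7 ≤ 4 * s := by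
    have : ((d + 7 : ℕ) : ℝ) ≤ ((4 * s : ℕ) : ℝ) := by
      push_cast
      linarith
    exact_mod_cast this
  have hs0 : 2 * s ≠ 0 := by omega
  obtain ⟨m, hm⟩ := hN
  have hN0 : 0 < N := by rw [hm]; positivity
  have hN0' : (0 : ℝ) < N := by exact_mod_cast hN0
  have hd' : (1 : ℝ) ≤ d := by exact_mod_cast hd
  set c := errorConst L T s p V with hc
  set X := (L * d / N) ^ (2 * s) with hX
  have hX0 : 0 ≤ X := by positivity
  have hdens : ∀ t ∈ Set.Icc 0 T, errorDensity L s (p t) (V t) ≤ (c - 1) / 3 := by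
    intro t ht
    have := le_csSup hbdd (Set.mem_image_of_mem _ ht)
    rw [hc, errorConst]
    linarith
  have hDnn : ∀ t, 0 ≤ torusL2Norm L (iteratedLaplacian (s + 1) (sqrtFun (p t))) := fun t =>
    torusL2Norm_nonneg _
  have hc1 : 1 ≤ c := by
    have h0 : (0 : ℝ) ∈ Set.Icc 0 T := Set.left_mem_Icc.2 hT.le
    have := (hDnn 0).trans ((torusL2Norm_le_errorDensity (V := V 0)).trans (hdens 0 h0))
    linarith
  -- The condition `δ ≤ T` bounds the discretization term `T c X` by `T`. With `1 ≤ c` this also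
  -- yields `L/N ≤ 1`.
  have hcX : c * X ≤ 1 := by
    have h1 : T * (c * X) ≤ T * 1 := by
      have := norm_nonneg (qsample N L (p 0) - φ 0)
      linarith
    exact le_of_mul_le_mul_left h1 hT
  have hX1 : X ≤ 1 := (le_mul_of_one_le_left hX0 hc1).trans hcX
  have hLdN : L / N ≤ L * d / N := by
    gcongr
    exact le_mul_of_one_le_right hL.le hd'
  have hLN : L / N ≤ 1 :=
    hLdN.trans ((pow_le_one_iff_of_nonneg (by positivity) hs0).1 hX1)
  have hLNX : (L / N) ^ (2 * s) ≤ X := pow_le_pow_left₀ (by positivity) hLdN _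
  have hlow : ∀ t ∈ Set.Icc 0 T, √((N / L) ^ d) / 2 ≤ ‖gridVector N L (sqrtFun (p t))‖ := by
    intro t ht
    refine norm_gridVector_ge hL hs' hN0 (hpC t ht) ?_ ?_ hLN
    · rw [← (hp t ht).2.2]
      congr 1
      funext x
      rw [sqrtFun, sq_abs, Real.sq_sqrt ((hp t ht).2.1 x)]
    -- The factor `3` in the error constant enters here: the product is at most `(c - 1) X / 3 ≤
    -- 1/3`.
    · have h1 := (torusL2Norm_le_errorDensity (V := V t)).trans (hdens t ht)
      have h2 := mul_le_mul h1 hLNX (by positivity) ((hDnn t).trans h1)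
      linarith
  have hne : ∀ t ∈ Set.Icc 0 T, gridVector N L (sqrtFun (p t)) ≠ 0 := by
    intro t ht
    have h1 := hlow t ht
    have h2 : 0 < √((N / L) ^ d) := Real.sqrt_pos.2 (by positivity)
    exact norm_pos_iff.1 (by linarith)
  refine ⟨fun t ht => norm_qsample (hne t ht), ?_⟩
  have h0mem : (0 : ℝ) ∈ Set.Icc 0 T := Set.left_mem_Icc.2 hT.le
  have hTmem : T ∈ Set.Icc 0 T := Set.right_mem_Icc.2 hT.le
  have hφ' : ∀ t ∈ Set.Icc 0 T,
      HasDerivWithinAt φ (discreteGenerator N L (V t) (φ t)) (Set.Icc 0 T) t := hφ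
  have h2le : (2 : ℕ) ≤ 2 * (s + 1) := by omega
  rcases Nat.eq_zero_or_pos m with rfl | hmpos
  · -- a single grid point
    obtain rfl : N = 1 := by simpa using hm
    -- For `N = 1` the frequency shift `N/2` is not an integer, so the aliasing estimate is
    -- unavailable. But the generator vanishes and the normalized sample is constantly `1`, hence
    -- the error does not grow at all.
    have h1 := norm_le_of_hasDerivWithinAt_skew (ε := 0) hT.le
      (w := fun t => (WithLp.toLp 2 fun _ => 1) - φ t) (r := fun _ => 0)
      (A := fun t => discreteGenerator 1 L (V t)) (fun t _ => inner_discreteGenerator (V t))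
      (fun t ht => by
        have := (hφ' t ht).const_sub (WithLp.toLp 2 fun _ => 1)
        simpa only [discreteGenerator_one, neg_zero, add_zero] using this)
      (fun t _ => norm_zero.le)
    rw [qsample_one (hne T hTmem)]
    rw [qsample_one (hne 0 h0mem)] at hδ
    have h2 : 0 ≤ T * c * X := by positivity
    linarith
  · have hM : N = 2 * 2 ^ (m - 1) := by
      rw [hm, ← pow_succ']
      congr 1
      omega
    -- Normalization doubles `ε`, so `c X / 2` produces exactly the term `T c X`. The lower bound
    -- `√((N/L)^d) / 2` on the sampled norm reduces the requirement to a defect of at most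
    -- `√((N/L)^d) · c X / 4`.
    have hmain := norm_normalized_sub_le (ε := c * X / 2) hT.le
      (u := fun t => gridVector N L (sqrtFun (p t)))
      (e := fun t => gridVector N L (flowRate (V t) (sqrtFun (p t))) -
        discreteGenerator N L (V t) (gridVector N L (sqrtFun (p t))))
      (A := fun t => discreteGenerator N L (V t)) (fun t _ => inner_discreteGenerator (V t))
      (fun t ht => by
        rw [add_sub_cancel]
        exact hasDerivWithinAt_gridVector fun x =>
          hasDerivWithinAt_sqrtFun (fun τ hτ => (hp τ hτ).2.1) hcont
            (fun τ hτ => ((hpC τ hτ).of_le h2le).2) (fun τ hτ => ((hVC τ hτ).of_le h2le).2)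
            hVt hpt hVpt ht x)
      hφ' hne
      (fun t ht => by
        refine (norm_gridVector_flowRate_sub_le hL hs' _ hM hN0 (hpC t ht) (hVC t ht)).trans ?_
        have h1 := hdens t ht
        have h3 := (hDnn t).trans (torusL2Norm_le_errorDensity (V := V t))
        have h4 := mul_le_mul hLNX h1 h3 hX0
        have h5 : 0 ≤ √((N / L) ^ d) := Real.sqrt_nonneg _
        have h6 : 1 / 8 * (L / N) ^ (2 * s) * errorDensity L s (p t) (V t) ≤ c * X / 4 := by
          have : 0 ≤ c * X := by positivity
          nlinarith
        have h7 := mul_le_mul_of_nonneg_left h6 h5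
        have h8 := mul_le_mul_of_nonneg_left (hlow t ht)
          (show 0 ≤ c * X / 2 by positivity)
        linarith)
    rw [qsample_eq_smul, hδ, qsample_eq_smul]
    linarith
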